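/- Let $K\in\mathbb R$ and $N<-1$. For $M<0$, $t\in[0,1]$ and $\theta\ge 0$ put \[ \sigma_{K,M}^{(t)}(\theta)=\begin{cases}\infty & \text{if } K\theta^2\le M\pi^2,\\[2pt] \dfrac{\sin(t\theta\sqrt{K/M})}{\sin(\theta\sqrt{K/M})} & \text{if } M\pi^2<K\theta^2<0,\\[2pt] t & \text{if } K\theta^2=0,\\[2pt] \dfrac{\sinh(t\theta\sqrt{-K/M})}{\sinh(\theta\sqrt{-K/M})} & \text{if } K\theta^2>0,\end{cases} \qquad \tau_{K,M}^{(t)}(\theta)=t^{1/M}\,\sigma_{K,M-1}^{(t)}(\theta)^{(M-1)/M}, \] where at $t=0$ one sets $\tau^{(0)}_{K,M}(\theta)=0$ if $K\theta^2>(M-1)\pi^2$ and $\tau^{(0)}_{K,M}(\theta)=\infty$ otherwise. Let $\psi:\mathbb R\to[-\infty,\infty)$ be $(K,N)$-convex, that is, with $\psi_N:=e^{-\psi/N}$ (so $\psi_N=0$ where $\psi=-\infty$), for all $x_0,x_1\in\mathbb R$, with $d:=|x_0-x_1|<\pi\sqrt{N/K}$ in case $K<0$, there is a constant speed geodesic $\gamma:[0,1]\to\mathbb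 R$ from $x_0$ to $x_1$ with \[ \psi_N(\gamma_t)\le \sigma_{K,N}^{(1-t)}(d)\,\psi_N(x_0)+\sigma_{K,N}^{(t)}(d)\,\psi_N(x_1)\qquad\text{for all } t\in[0,1]. \] Assume that $\mathcal L^1(\{\psi=-\infty\})=0$; no further regularity of $\psi$ is assumed. Then, with $\mathfrak m:=e^{-\psi}\mathcal L^1$, the space $(\mathbb R,|\cdot|,\mathfrak m)$ is a $\mathsf{CD}(K,N+1)$ space. This means the following. (a) $(\mathbb R,|\cdot|,\mathfrak m)$ is a metric measure space: $\mathfrak m$ is a non-zero quasi-Radon measure on the complete separable metric space $(\mathbb R,|\cdot|)$, i.e. every Borel set $A$ with $\mathfrak m(A)>0$ satisfies $\mathfrak m(A\cap U)>0$ for some open set $U$ with $\mathfrak m(U)<\infty$, and $\mathfrak m$ is inner regular with respect to closed sets (Borel measures being identified with their completions). (b) For a Borel probability measure $\mu$ and $M<0$ let $S_{M,\mathfrak m}(\mu)=\int\rho^{(M-1)/M}\,d\mathfrak m$ if $\mu=\rho\,\mathfrak m$ is absolutely continuous with respect to $\mathfrak m$, and $S_{M,\mathfrak m}(\mu)=+\infty$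 otherwise. Then for all probability measures $\mu_0=\rho_0\mathfrak m$ and $\mu_1=\rho_1\mathfrak m$ on $\mathbb R$ with finite second moment there exist a coupling $\pi$ of $\mu_0$ and $\mu_1$ that is optimal for the cost $|x-y|^2$ and a constant speed $W_2$-geodesic $(\mu_t)_{t\in[0,1]}$ from $\mu_0$ to $\mu_1$, consisting of probability measures with finite second moment, such that \[ S_{N',\mathfrak m}(\mu_t)\le\int\Big[\tau_{K,N'}^{(1-t)}(|x-y|)\,\rho_0(x)^{-1/N'}+\tau_{K,N'}^{(t)}(|x-y|)\,\rho_1(y)^{-1/N'}\Big]\,d\pi(x,y) \] for every $t\in[0,1]$ and every $N'\in[N+1,0)$ for which $S_{N',\mathfrak m}(\mu_0)<\infty$ and $S_{N',\mathfrak m}(\mu_1)<\infty$. -/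

import Mathlib

open MeasureTheory Set
open scoped ENNReal

noncomputable section

namespace NegCD

/-- The distortion coefficient `σ_{K,N}^{(t)}(θ)` (also written `σ_{K/N}^{(t)}(θ)`) for `N < 0`,
`t ∈ [0,1]` and `θ ≥ 0`, with values in `[0,∞]`. -/
def sigma (K N t θ : ℝ) : ℝ≥0∞ :=
  if K * θ ^ 2 ≤ N * Real.pi ^ 2 then ∞
  else if K * θ ^ 2 < 0 then
    ENNReal.ofReal (Real.sin (t * θ * √(K / N)) / Real.sin (θ * √(K / N)))
  else if K * θ ^ 2 = 0 then ENNReal.ofReal t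
  else ENNReal.ofReal (Real.sinh (t * θ * √(-K / N)) / Real.sinh (θ * √(-K / N)))

/-- The distortion coefficient `τ_{K,N}^{(t)}(θ) = t^{1/N} σ_{K,N-1}^{(t)}(θ)^{(N-1)/N}` for
`N < 0`. At `t = 0` the first factor is `∞`; there `∞ * 0 = 0`, the limit of `τ` as `t → 0`,
when `σ` is finite, and `τ = ∞` when `σ = ∞`. -/
def tau (K N t θ : ℝ) : ℝ≥0∞ :=
  ENNReal.ofReal t ^ (1 / N) * sigma K (N - 1) t θ ^ ((N - 1) / N)

/-- `γ`, restricted to `[0,1]`, is a constant speed geodesic from `a` to `b` for the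
(extended) distance `d`. -/
def IsGeodesic {α : Type*} (d : α → α → ℝ≥0∞) (γ : ℝ → α) (a b : α) : Prop :=
  γ 0 = a ∧ γ 1 = b ∧
    ∀ s ∈ Icc (0 : ℝ) 1, ∀ t ∈ Icc (0 : ℝ) 1,
      d (γ s) (γ t) = ENNReal.ofReal |s - t| * d a b

/-- `f_N = e^{-f/N}`, with values in `[0,∞]`; for `N < 0` it is `0` where `f = -∞`
and `∞` where `f = +∞`. -/
def expWeight {X : Type*} (f : X → EReal) (N : ℝ) (x : X) : ℝ≥0∞ :=
  EReal.exp (-(f x) / (N : EReal))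

/-- `(K,N)`-convexity, for `N < 0`, of an extended-real-valued function on a metric space. -/
def IsKNConvex {X : Type*} [MetricSpace X] (K N : ℝ) (f : X → EReal) : Prop :=
  ∀ x₀ x₁ : X, f x₀ < ⊤ → f x₁ < ⊤ → (K < 0 → dist x₀ x₁ < Real.pi * √(N / K)) →
    ∃ γ : ℝ → X, IsGeodesic edist γ x₀ x₁ ∧
      ∀ t ∈ Icc (0 : ℝ) 1,
        expWeight f N (γ t) ≤
          sigma K N (1 - t) (dist x₀ x₁) * expWeight f N x₀ +
            sigma K N t (dist x₀ x₁) * expWeight f N x₁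

section Transport

variable {X : Type*} [MetricSpace X] [MeasurableSpace X]

/-- Borel probability measures with finite second moment. -/
def IsP2 (μ : Measure X) : Prop :=
  IsProbabilityMeasure μ ∧ ∃ x₀ : X, ∫⁻ x, edist x x₀ ^ 2 ∂μ < ∞

/-- The set `Adm(μ,ν)` of couplings of `μ` and `ν`. -/
def couplings (μ ν : Measure X) : Set (Measure (X × X)) :=
  {π | π.map Prod.fst = μ ∧ π.map Prod.snd = ν}

/-- The quadratic transport cost of a plan. -/
def transportCost (π : Measure (X × X)) : ℝ≥0∞ :=
  ∫⁻ p, edist p.1 p.2 ^ 2 ∂π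

/-- The 2-Wasserstein distance. -/
def W2 (μ ν : Measure X) : ℝ≥0∞ :=
  (⨅ π ∈ couplings μ ν, transportCost π) ^ (1 / 2 : ℝ)

/-- The set `Opt(μ,ν)` of optimal couplings of `μ` and `ν`. -/
def optimalCouplings (μ ν : Measure X) : Set (Measure (X × X)) :=
  {π | π ∈ couplings μ ν ∧ transportCost π = W2 μ ν ^ 2}

open Classical in
/-- The Rényi entropy `S_{N,m}` for `N < 0`. -/
def renyiEntropy (N : ℝ) (m μ : Measure X) : ℝ≥0∞ :=
  if μ ≪ m then ∫⁻ x, μ.rnDeriv m x ^ ((N - 1) / N) ∂m else ∞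

/-- The functional `T_{K,N}^{(t)}(π | m)`, for a coupling `π` of `μ₀ = ρ₀ m` and `μ₁ = ρ₁ m`. -/
def distortedEntropy (K N t : ℝ) (m μ₀ μ₁ : Measure X) (π : Measure (X × X)) : ℝ≥0∞ :=
  ∫⁻ p, (tau K N (1 - t) (dist p.1 p.2) * μ₀.rnDeriv m p.1 ^ (-1 / N) +
    tau K N t (dist p.1 p.2) * μ₁.rnDeriv m p.2 ^ (-1 / N)) ∂π

/-- The `CD(K,N)`-condition for `N < 0`. -/
def CDCondition (K N : ℝ) (m : Measure X) : Prop :=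
  ∀ μ₀ μ₁ : Measure X, IsP2 μ₀ → IsP2 μ₁ → μ₀ ≪ m → μ₁ ≪ m →
    ∃ π ∈ optimalCouplings μ₀ μ₁, ∃ μ : ℝ → Measure X,
      IsGeodesic W2 μ μ₀ μ₁ ∧ (∀ t ∈ Icc (0 : ℝ) 1, IsP2 (μ t)) ∧
        ∀ N' ∈ Ico N 0, renyiEntropy N' m μ₀ < ∞ → renyiEntropy N' m μ₁ < ∞ →
          ∀ t ∈ Icc (0 : ℝ) 1,
            renyiEntropy N' m (μ t) ≤ distortedEntropy K N' t m μ₀ μ₁ π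

/-- Every measurable set of positive measure meets some open set of finite measure in a set of
positive measure. -/
def EffectivelyLocallyFinite (m : Measure X) : Prop :=
  ∀ A, MeasurableSet A → 0 < m A → ∃ U, IsOpen U ∧ m U < ∞ ∧ 0 < m (A ∩ U)

/-- Quasi-Radon measures on a metric space with its Borel `σ`-algebra. A Borel measure is
identified with its completion, which changes neither of the two conditions. -/
structure IsQuasiRadon (m : Measure X) : Prop where
  effectivelyLocallyFinite : EffectivelyLocallyFinite m
  innerRegular : m.InnerRegularWRT IsClosed MeasurableSet

/-- `(X,d,m)` is a metric measure space: `X` is complete and separable and `m` is a non-zero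
quasi-Radon measure. -/
structure IsMetricMeasureSpace (m : Measure X) : Prop where
  borel : BorelSpace X
  complete : CompleteSpace X
  separable : TopologicalSpace.SeparableSpace X
  ne_zero : m ≠ 0
  quasiRadon : IsQuasiRadon m

/-- `(X,d,m)` is a `CD(K,N)` space: a metric measure space satisfying the `CD(K,N)`-condition. -/
structure IsCDSpace (K N : ℝ) (m : Measure X) : Prop where
  isMetricMeasureSpace : IsMetricMeasureSpace m
  cd : CDCondition K N m

end Transport

/-- The measure `e^{-ψ} ℒ¹` on the real line. -/
def weightedLebesgue (ψ : ℝ → EReal) : Measure ℝ :=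
  (volume : Measure ℝ).withDensity fun x => EReal.exp (-(ψ x))

end NegCD

end

/-! Put g = e^{-ψ/N}, so that the reference measure is m = g^N dx. Geodesics on the line are affine,
so (K,N)-convexity says exactly that g lies below the solutions of v'' + (K/N)v = 0 with the same
boundary values (`IsSturmConvex`). This alone makes g continuous, and g > 0 almost everywhere by
assumption; part (a) follows by exhausting the open set {g > 0}.

For the entropy inequality, let X and Y be the quantile functions of μ₀ and μ₁ on (0,1). The law of
(X,Y) is an optimal coupling and the laws of Z = (1-t)X + tY form a W₂-geodesic. Monotonicity and
absolute continuity give X', Y' > 0 almost everywhere, and change of variables gives ρ_t(Z) Z'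
g(Z)^N = 1. Hence S_n(μ_t) is the integral over (0,1) of (Z' g(Z)^N)^{1/n} (`renyiEntropy_map`), and
it suffices to prove the inequality pointwise in u (`ofReal_rpow_le_tau`).

Two facts give the pointwise inequality. First, α = N/(n-1) ≥ 1 because N+1 ≤ n < 0, and Sturm
comparison shows that g^α lies below solutions of v'' + (K/(n-1))v = 0; this produces the
coefficients σ_{K,n-1}. Second, with p = (n-1)/n ≥ 1, the function A^{1-p} c^p is subadditive in
(A,c), being the perspective of c^p; with A-terms (1-t)X', tY' and c-terms σ g^α it produces t^{1/n}
σ^{(n-1)/n} = τ. -/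

namespace NegCD

open Filter Topology

/-! ### Generalised trigonometric functions and Sturm comparison -/

/-- The generalised sine: the solution of `s'' + κ s = 0` with `s 0 = 0` and `s' 0 = 1`. -/
noncomputable def gsin (κ x : ℝ) : ℝ :=
  if 0 < κ then Real.sin (x * √κ) / √κ
  else if κ = 0 then x
  else Real.sinh (x * √(-κ)) / √(-κ)

/-- The generalised cosine, the derivative of the generalised sine. -/
noncomputable def gcos (κ x : ℝ) : ℝ :=
  if 0 < κ then Real.cos (x * √κ)
  else if κ = 0 then 1
  else Real.cosh (x * √(-κ))

theorem gsin_zero (κ : ℝ) : gsin κ 0 = 0 := by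
  unfold gsin; split_ifs <;> simp

theorem hasDerivAt_gsin (κ x : ℝ) : HasDerivAt (gsin κ) (gcos κ x) x := by
  unfold gsin gcos
  split_ifs with h h0
  · have hs : √κ ≠ 0 := (Real.sqrt_pos.2 h).ne'
    exact ((((hasDerivAt_id' x).mul_const (√κ)).sin).div_const (√κ)).congr_deriv (by field_simp)
  · exact hasDerivAt_id x
  · have hs : √(-κ) ≠ 0 := (Real.sqrt_pos.2 (neg_pos.2 (lt_of_le_of_ne (not_lt.1 h) h0))).ne'
    exact ((((hasDerivAt_id' x).mul_const (√(-κ))).sinh).div_const (√(-κ))).congr_deriv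
      (by field_simp)

theorem hasDerivAt_gcos (κ x : ℝ) : HasDerivAt (gcos κ) (-κ * gsin κ x) x := by
  unfold gsin gcos
  split_ifs with h h0
  · have hs : √κ ≠ 0 := (Real.sqrt_pos.2 h).ne'
    refine (((hasDerivAt_id' x).mul_const (√κ)).cos).congr_deriv ?_
    have h2 := Real.sq_sqrt h.le
    field_simp
    rw [h2]; ring
  · subst h0; simpa using hasDerivAt_const x (1 : ℝ)
  · have hk : 0 < -κ := neg_pos.2 (lt_of_le_of_ne (not_lt.1 h) h0)
    have hs : √(-κ) ≠ 0 := (Real.sqrt_pos.2 hk).ne'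
    refine (((hasDerivAt_id' x).mul_const (√(-κ))).cosh).congr_deriv ?_
    have h2 := Real.sq_sqrt hk.le
    field_simp
    rw [h2]; ring

theorem continuous_gsin (κ : ℝ) : Continuous (gsin κ) :=
  continuous_iff_continuousAt.2 fun x => (hasDerivAt_gsin κ x).continuousAt

theorem gsin_pos {κ x : ℝ} (hx : 0 < x) (h : κ * x ^ 2 < Real.pi ^ 2) : 0 < gsin κ x := by
  unfold gsin
  split_ifs with h1 h0
  · have hs := Real.sqrt_pos.2 h1
    refine div_pos (Real.sin_pos_of_pos_of_lt_pi (by positivity) ?_) hs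
    refine lt_of_pow_lt_pow_left₀ 2 Real.pi_pos.le ?_
    rw [mul_pow, Real.sq_sqrt h1.le]; linarith
  · exact hx
  · have hk : 0 < -κ := neg_pos.2 (lt_of_le_of_ne (not_lt.1 h1) h0)
    have hs := Real.sqrt_pos.2 hk
    exact div_pos (Real.sinh_pos_iff.2 (by positivity)) hs

theorem mul_sq_lt_of_le {κ x y c : ℝ} (hx : 0 ≤ x) (hxy : x ≤ y) (hc : 0 < c)
    (h : κ * y ^ 2 < c) : κ * x ^ 2 < c := by
  have h2 : x ^ 2 ≤ y ^ 2 := by gcongr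
  rcases le_or_gt κ 0 with hk | hk
  · nlinarith [sq_nonneg x]
  · nlinarith

/-- Maximum principle for `w'' + κ w ≥ 0` on an interval that carries a positive solution of
`q'' + κ q = 0`. -/
theorem nonpos_of_hasDerivAt_of_le {κ d : ℝ} {w w' w'' q q' : ℝ → ℝ}
    (hw : ∀ x ∈ Icc 0 d, HasDerivAt w (w' x) x) (hw' : ∀ x ∈ Icc 0 d, HasDerivAt w' (w'' x) x)
    (hq : ∀ x ∈ Icc 0 d, HasDerivAt q (q' x) x)
    (hq' : ∀ x ∈ Icc 0 d, HasDerivAt q' (-κ * q x) x)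
    (hpos : ∀ x ∈ Icc 0 d, 0 < q x) (hle : ∀ x ∈ Icc 0 d, 0 ≤ w'' x + κ * w x)
    (h0 : w 0 = 0) (hd : w d = 0) {x : ℝ} (hx : x ∈ Ioo 0 d) : w x ≤ 0 := by
  -- The Wronskian W = w'q - wq' satisfies W' = (w'' + κw)q ≥ 0, and (w/q)' = W/q². If w(x) > 0, the
  -- mean value theorem for w/q gives W > 0 somewhere left of x and W < 0 somewhere right of x,
  -- against monotonicity.
  set W : ℝ → ℝ := fun y => w' y * q y - w y * q' y with hW
  have hWd : ∀ y ∈ Icc 0 d, HasDerivAt W ((w'' y + κ * w y) * q y) y := by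
    intro y hy
    exact (((hw' y hy).mul (hq y hy)).sub ((hw y hy).mul (hq' y hy))).congr_deriv (by ring)
  have hmono : MonotoneOn W (Icc 0 d) := by
    refine monotoneOn_of_deriv_nonneg (convex_Icc 0 d)
      (fun y hy => (hWd y hy).continuousAt.continuousWithinAt)
      (fun y hy => (hWd y (interior_subset hy)).differentiableAt.differentiableWithinAt) ?_
    intro y hy
    rw [(hWd y (interior_subset hy)).deriv]
    exact mul_nonneg (hle y (interior_subset hy)) (hpos y (interior_subset hy)).le
  have hz : ∀ y ∈ Icc 0 d, HasDerivAt (fun y => w y / q y) (W y / q y ^ 2) y := fun y hy =>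
    (hw y hy).div (hq y hy) (hpos y hy).ne'
  by_contra! hwx
  have hxq := hpos x ⟨hx.1.le, hx.2.le⟩
  obtain ⟨a, ha, hae⟩ := exists_hasDerivAt_eq_slope (fun y => w y / q y) _ hx.1
    (fun y hy => (hz y ⟨hy.1, hy.2.trans hx.2.le⟩).continuousAt.continuousWithinAt)
    (fun y hy => hz y ⟨hy.1.le, hy.2.le.trans hx.2.le⟩)
  obtain ⟨b, hb, hbe⟩ := exists_hasDerivAt_eq_slope (fun y => w y / q y) _ hx.2
    (fun y hy => (hz y ⟨hx.1.le.trans hy.1, hy.2⟩).continuousAt.continuousWithinAt)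
    (fun y hy => hz y ⟨hx.1.le.trans hy.1.le, hy.2.le⟩)
  have ha' : a ∈ Icc 0 d := ⟨ha.1.le, ha.2.le.trans hx.2.le⟩
  have hb' : b ∈ Icc 0 d := ⟨hx.1.le.trans hb.1.le, hb.2.le⟩
  simp only [h0, hd, zero_div, sub_zero, zero_sub] at hae hbe
  have hWa : 0 < W a := by
    have : 0 < W a / q a ^ 2 := hae ▸ div_pos (div_pos hwx hxq) hx.1
    exact (div_pos_iff_of_pos_right (pow_pos (hpos a ha') 2)).1 this
  have hWb : W b < 0 := by
    have : W b / q b ^ 2 < 0 := by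
      rw [hbe]; exact div_neg_of_neg_of_pos (by simpa using div_pos hwx hxq) (sub_pos.2 hx.2)
    by_contra! hc
    exact absurd (div_nonneg hc (pow_pos (hpos b hb') 2).le) this.not_ge
  exact absurd (hmono ha' hb' (ha.2.trans hb.1).le) (by linarith [hWa, hWb])

/-- The solution of `v'' + κ v = 0` with `v 0 = a` and `v d = b`. -/
noncomputable def interpolant (κ d a b x : ℝ) : ℝ :=
  (gsin κ (d - x) * a + gsin κ x * b) / gsin κ d

theorem interpolant_left {κ d : ℝ} (a b : ℝ) (hd : gsin κ d ≠ 0) :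
    interpolant κ d a b 0 = a := by
  simp [interpolant, gsin_zero, hd]

theorem interpolant_right {κ d : ℝ} (a b : ℝ) (hd : gsin κ d ≠ 0) :
    interpolant κ d a b d = b := by
  simp [interpolant, gsin_zero, hd]

theorem interpolant_pos {κ d a b x : ℝ} (ha : 0 < a) (hb : 0 < b) (hx : x ∈ Icc 0 d) (hd : 0 < d)
    (h : κ * d ^ 2 < Real.pi ^ 2) : 0 < interpolant κ d a b x := by
  have hpi : 0 < Real.pi ^ 2 := by positivity
  have hS : ∀ y ∈ Icc 0 d, 0 ≤ gsin κ y := by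
    intro y hy
    rcases hy.1.eq_or_lt with h0 | h0
    · rw [← h0, gsin_zero]
    · exact (gsin_pos h0 (mul_sq_lt_of_le hy.1 hy.2 hpi h)).le
  refine div_pos ?_ (gsin_pos hd h)
  rcases hx.1.eq_or_lt with h0 | h0
  · rw [← h0, gsin_zero, sub_zero]
    have := gsin_pos hd h
    nlinarith
  · have h1 := gsin_pos h0 (mul_sq_lt_of_le hx.1 hx.2 hpi h)
    have h2 := hS (d - x) ⟨by linarith [hx.2], by linarith⟩
    have h3 := mul_nonneg h2 ha.le
    have h4 := mul_pos h1 hb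
    linarith

/-- The derivative of `interpolant`. -/
noncomputable def interpolantDeriv (κ d a b x : ℝ) : ℝ :=
  (-gcos κ (d - x) * a + gcos κ x * b) / gsin κ d

theorem hasDerivAt_interpolant (κ d a b x : ℝ) :
    HasDerivAt (interpolant κ d a b) (interpolantDeriv κ d a b x) x := by
  have h1 : HasDerivAt (fun x => gsin κ (d - x)) (-gcos κ (d - x)) x := by
    simpa using (hasDerivAt_gsin κ (d - x)).comp_const_sub d x
  exact ((h1.mul_const a).add ((hasDerivAt_gsin κ x).mul_const b)).div_const _

theorem hasDerivAt_interpolantDeriv (κ d a b x : ℝ) :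
    HasDerivAt (interpolantDeriv κ d a b) (-κ * interpolant κ d a b x) x := by
  have h1 : HasDerivAt (fun x => gcos κ (d - x)) (-(-κ * gsin κ (d - x))) x := by
    simpa using (hasDerivAt_gcos κ (d - x)).comp_const_sub d x
  refine (((h1.neg.mul_const a).add ((hasDerivAt_gcos κ x).mul_const b)).div_const
    (gsin κ d)).congr_deriv ?_
  unfold interpolant
  ring

/-- Powers of solutions of `v'' + κ v = 0` lie below the solutions of `u'' + ακ u = 0` with the
same boundary values. -/
theorem interpolant_rpow_le {κ α d a b x : ℝ} (hα : 1 ≤ α) (hd : 0 < d)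
    (h : α * κ * d ^ 2 < Real.pi ^ 2) (ha : 0 < a) (hb : 0 < b) (hx : x ∈ Ioo 0 d) :
    interpolant κ d a b x ^ α ≤ interpolant (α * κ) d (a ^ α) (b ^ α) x := by
  have hpi : 0 < Real.pi ^ 2 := by positivity
  have hκ : κ * d ^ 2 < Real.pi ^ 2 := by
    rcases le_or_gt κ 0 with hk | hk
    · nlinarith [sq_nonneg d]
    · have : κ * d ^ 2 ≤ α * (κ * d ^ 2) := le_mul_of_one_le_left (by positivity) hα
      linarith
  -- The comparison function q is the sine shifted by ε, so that it is positive at the left endpoint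
  -- too; the strict bound on d leaves room for the shift.
  obtain ⟨ε, hε, hεd⟩ : ∃ ε > 0, α * κ * (d + ε) ^ 2 < Real.pi ^ 2 := by
    have hc : Continuous fun ε : ℝ => α * κ * (d + ε) ^ 2 := by fun_prop
    have h1 : ∀ᶠ ε in 𝓝[>] (0 : ℝ), α * κ * (d + ε) ^ 2 < Real.pi ^ 2 :=
      nhdsWithin_le_nhds (hc.continuousAt.eventually_lt continuousAt_const (by simpa using h))
    obtain ⟨ε, h2, h3⟩ := (h1.and self_mem_nhdsWithin).exists
    exact ⟨ε, h3, h2⟩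
  set φ := interpolant κ d a b
  set φ' := interpolantDeriv κ d a b
  have hφ : ∀ y ∈ Icc 0 d, 0 < φ y := fun y hy => interpolant_pos ha hb hy hd hκ
  have key := nonpos_of_hasDerivAt_of_le (κ := α * κ) (d := d)
    (w := fun y => φ y ^ α - interpolant (α * κ) d (a ^ α) (b ^ α) y)
    (w' := fun y => φ' y * α * φ y ^ (α - 1) - interpolantDeriv (α * κ) d (a ^ α) (b ^ α) y)
    (w'' := fun y => (-κ * φ y * α * φ y ^ (α - 1) +
      φ' y * α * (φ' y * (α - 1) * φ y ^ (α - 1 - 1)))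
      - -(α * κ) * interpolant (α * κ) d (a ^ α) (b ^ α) y)
    (q := fun y => gsin (α * κ) (y + ε)) (q' := fun y => gcos (α * κ) (y + ε))
    (fun y hy => ((hasDerivAt_interpolant κ d a b y).rpow_const (Or.inl (hφ y hy).ne')).sub
      (hasDerivAt_interpolant _ _ _ _ y))
    (fun y hy => ((((hasDerivAt_interpolantDeriv κ d a b y).mul_const α).mul
      ((hasDerivAt_interpolant κ d a b y).rpow_const (Or.inl (hφ y hy).ne'))).sub
      (hasDerivAt_interpolantDeriv _ _ _ _ y)))
    (fun y _ => by simpa using (hasDerivAt_gsin (α * κ) (y + ε)).comp_add_const y ε)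
    (fun y _ => by simpa using (hasDerivAt_gcos (α * κ) (y + ε)).comp_add_const y ε)
    (fun y hy => gsin_pos (by linarith [hy.1])
      (mul_sq_lt_of_le (by linarith [hy.1]) (by linarith [hy.2]) hpi hεd))
    (fun y hy => ?_) ?_ ?_ hx
  · linarith
  -- After cancellation w'' + ακw = α(α-1) φ'² φ^(α-2), which is nonnegative because α ≥ 1.
  · have e1 : φ y * φ y ^ (α - 1) = φ y ^ α := by
      rw [mul_comm, ← Real.rpow_add_one (hφ y hy).ne']; ring_nf
    have h2 : 0 ≤ α * (α - 1) * φ' y ^ 2 * φ y ^ (α - 1 - 1) := by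
      have := Real.rpow_nonneg (hφ y hy).le (α - 1 - 1)
      have : 0 ≤ α - 1 := by linarith
      positivity
    have e3 : -κ * φ y * α * φ y ^ (α - 1) = -κ * α * φ y ^ α := by rw [← e1]; ring
    rw [e3]
    nlinarith
  · have hg := (gsin_pos hd h).ne'
    have hg' := (gsin_pos hd hκ).ne'
    simp only [φ, interpolant_left _ _ hg, interpolant_left _ _ hg', sub_self]
  · have hg := (gsin_pos hd h).ne'
    have hg' := (gsin_pos hd hκ).ne'
    simp only [φ, interpolant_right _ _ hg, interpolant_right _ _ hg', sub_self]

/-! ### Functions below Sturm solutions -/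

/-- Real functions that lie below the solutions of `v'' + κ v = 0`. -/
def IsSturmConvex (κ : ℝ) (g : ℝ → ℝ) : Prop :=
  ∀ x y z, x < y → y < z → κ * (z - x) ^ 2 < Real.pi ^ 2 →
    gsin κ (z - x) * g y ≤ gsin κ (z - y) * g x + gsin κ (y - x) * g z

theorem IsSturmConvex.comp_neg {κ : ℝ} {g : ℝ → ℝ} (hg : IsSturmConvex κ g) :
    IsSturmConvex κ fun x => g (-x) := by
  intro x y z hxy hyz h
  have := hg (-z) (-y) (-x) (by linarith) (by linarith) (by ring_nf at h ⊢; exact h)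
  rw [show -x - -z = z - x by ring, show -x - -y = y - x by ring, show -y - -z = z - y by ring]
    at this
  linarith

/-- Right of p, the inequality on p < x < p + r bounds g x from above, and the inequality on p - r <
p < x, solved for g x, bounds it from below; both barriers tend to g p. All intervals have length at
most 2r. -/
theorem IsSturmConvex.continuousWithinAt_Ioi {κ : ℝ} {g : ℝ → ℝ} (hg : IsSturmConvex κ g)
    (p : ℝ) : ContinuousWithinAt g (Ioi p) p := by
  have hpi : 0 < Real.pi ^ 2 := by positivity
  obtain ⟨r, hr, hrd⟩ : ∃ r > 0, κ * (2 * r) ^ 2 < Real.pi ^ 2 := by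
    have hc : Continuous fun r : ℝ => κ * (2 * r) ^ 2 := by fun_prop
    have h1 : ∀ᶠ r in 𝓝[>] (0 : ℝ), κ * (2 * r) ^ 2 < Real.pi ^ 2 :=
      nhdsWithin_le_nhds (hc.continuousAt.eventually_lt continuousAt_const (by simpa using hpi))
    obtain ⟨ε, h2, h3⟩ := (h1.and self_mem_nhdsWithin).exists
    exact ⟨ε, h3, h2⟩
  have hS := gsin_pos hr (mul_sq_lt_of_le hr.le (by linarith) hpi hrd)
  have hc := continuous_gsin κ
  have hup : Tendsto (fun x => (gsin κ (p + r - x) * g p + gsin κ (x - p) * g (p + r)) / gsin κ r)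
      (𝓝[>] p) (𝓝 (g p)) := by
    have : Continuous fun x =>
        (gsin κ (p + r - x) * g p + gsin κ (x - p) * g (p + r)) / gsin κ r := by fun_prop
    have h := this.tendsto p
    rw [show p + r - p = r by ring, sub_self, gsin_zero, zero_mul, add_zero,
      mul_div_cancel_left₀ _ hS.ne'] at h
    exact h.mono_left nhdsWithin_le_nhds
  have hlo : Tendsto (fun x => (gsin κ (x - p + r) * g p - gsin κ (x - p) * g (p - r)) / gsin κ r)
      (𝓝[>] p) (𝓝 (g p)) := by
    have : Continuous fun x =>
        (gsin κ (x - p + r) * g p - gsin κ (x - p) * g (p - r)) / gsin κ r := by fun_prop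
    have h := this.tendsto p
    rw [sub_self, gsin_zero, zero_mul, sub_zero, zero_add, mul_div_cancel_left₀ _ hS.ne'] at h
    exact h.mono_left nhdsWithin_le_nhds
  have hmem : Ioo p (p + r) ∈ 𝓝[>] p := Ioo_mem_nhdsGT (by linarith)
  refine tendsto_of_tendsto_of_tendsto_of_le_of_le' hlo hup ?_ ?_
  · filter_upwards [hmem] with x hx
    rw [div_le_iff₀ hS]
    have := hg (p - r) p x (by linarith) hx.1
      (mul_sq_lt_of_le (by linarith [hx.1]) (by linarith [hx.2]) hpi hrd)
    rw [show x - (p - r) = x - p + r by ring, show p - (p - r) = r by ring] at this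
    linarith
  · filter_upwards [hmem] with x hx
    rw [le_div_iff₀ hS]
    have := hg p x (p + r) hx.1 hx.2 (mul_sq_lt_of_le (by linarith) (by linarith) hpi hrd)
    rw [show p + r - p = r by ring] at this
    linarith

theorem IsSturmConvex.continuous {κ : ℝ} {g : ℝ → ℝ} (hg : IsSturmConvex κ g) : Continuous g := by
  refine continuous_iff_continuousAt.2 fun p => continuousAt_iff_continuous_left'_right'.2
    ⟨?_, hg.continuousWithinAt_Ioi p⟩
  have h := hg.comp_neg.continuousWithinAt_Ioi (-p)
  have := h.comp (f := fun x : ℝ => -x) (x := p) (s := Iio p) continuous_neg.continuousWithinAt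
    (fun x hx => by simpa using hx)
  simpa [Function.comp_def] using this

theorem IsSturmConvex.rpow_le {κ α : ℝ} {g : ℝ → ℝ} (hg : IsSturmConvex κ g) (hα : 1 ≤ α)
    {x z t : ℝ} (hxz : x < z) (ht : t ∈ Ioo (0 : ℝ) 1) (hx : 0 < g x) (hz : 0 < g z)
    (hg0 : ∀ y, 0 ≤ g y) (h : α * κ * (z - x) ^ 2 < Real.pi ^ 2) :
    g ((1 - t) * x + t * z) ^ α ≤
      gsin (α * κ) ((1 - t) * (z - x)) / gsin (α * κ) (z - x) * g x ^ α +
        gsin (α * κ) (t * (z - x)) / gsin (α * κ) (z - x) * g z ^ α := by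
  have hd : 0 < z - x := sub_pos.2 hxz
  have hκ : κ * (z - x) ^ 2 < Real.pi ^ 2 := by
    rcases le_or_gt κ 0 with hk | hk
    · nlinarith [sq_nonneg (z - x), Real.pi_pos]
    · have : κ * (z - x) ^ 2 ≤ α * (κ * (z - x) ^ 2) := le_mul_of_one_le_left (by positivity) hα
      linarith
  have hy : t * (z - x) ∈ Ioo 0 (z - x) := ⟨mul_pos ht.1 hd, by nlinarith [ht.2]⟩
  have h1 := hg x ((1 - t) * x + t * z) z (by nlinarith [ht.1]) (by nlinarith [ht.2]) hκ
  rw [show z - ((1 - t) * x + t * z) = z - x - t * (z - x) by ring,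
    show (1 - t) * x + t * z - x = t * (z - x) by ring, mul_comm,
    ← le_div_iff₀ (gsin_pos hd hκ)] at h1
  refine (Real.rpow_le_rpow (hg0 _) h1 (by linarith)).trans
    ((interpolant_rpow_le hα hd h hx hz hy).trans_eq ?_)
  unfold interpolant
  rw [show z - x - t * (z - x) = (1 - t) * (z - x) by ring]
  ring

/-! ### Distortion coefficients and (K,N)-convexity on the line -/

theorem sigma_eq_top {K N θ : ℝ} (t : ℝ) (h : K * θ ^ 2 ≤ N * Real.pi ^ 2) :
    sigma K N t θ = ∞ := if_pos h

theorem sigma_eq_gsin {K N t θ : ℝ} (hN : N < 0) (hθ : 0 < θ) (h : N * Real.pi ^ 2 < K * θ ^ 2) :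
    sigma K N t θ = ENNReal.ofReal (gsin (K / N) (t * θ) / gsin (K / N) θ) := by
  have hθ2 : 0 < θ ^ 2 := by positivity
  unfold sigma gsin
  rw [if_neg h.not_ge]
  rcases lt_trichotomy K 0 with hK | hK | hK
  · have hk : 0 < K / N := div_pos_of_neg_of_neg hK hN
    rw [if_pos (by nlinarith), if_pos hk, if_pos hk,
      div_div_div_cancel_right₀ (Real.sqrt_pos.2 hk).ne']
  · subst hK
    simp [hθ.ne']
  · have hk : K / N < 0 := div_neg_of_pos_of_neg hK hN
    have hk' : 0 < -(K / N) := by linarith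
    rw [if_neg (by nlinarith), if_neg (by nlinarith), if_neg hk.not_gt, if_neg hk.ne,
      if_neg hk.not_gt, if_neg hk.ne, div_div_div_cancel_right₀ (Real.sqrt_pos.2 hk').ne', neg_div]

theorem sigma_zero_right {K N t : ℝ} (hN : N < 0) : sigma K N t 0 = ENNReal.ofReal t := by
  have : ¬ (0 : ℝ) ≤ N * Real.pi ^ 2 := by
    have := Real.pi_pos; have : 0 < Real.pi ^ 2 := by positivity
    nlinarith
  simp [sigma, this]

theorem div_mul_sq_lt_iff {K N θ : ℝ} (hN : N < 0) :
    K / N * θ ^ 2 < Real.pi ^ 2 ↔ N * Real.pi ^ 2 < K * θ ^ 2 := by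
  rw [div_mul_eq_mul_div, div_lt_iff_of_neg hN, mul_comm N]

theorem eq_lineMap_of_isGeodesic {γ : ℝ → ℝ} {a b t : ℝ} (h : IsGeodesic edist γ a b)
    (ht : t ∈ Icc (0 : ℝ) 1) : γ t = (1 - t) * a + t * b := by
  obtain ⟨h0, h1, h2⟩ := h
  have e0 := h2 t ht 0 (by simp)
  have e1 := h2 t ht 1 (by simp)
  rw [h0, edist_dist, edist_dist, ← ENNReal.ofReal_mul (abs_nonneg _),
    ENNReal.ofReal_eq_ofReal_iff dist_nonneg (by positivity), Real.dist_eq, Real.dist_eq, sub_zero,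
    abs_of_nonneg ht.1] at e0
  rw [h1, edist_dist, edist_dist, ← ENNReal.ofReal_mul (abs_nonneg _),
    ENNReal.ofReal_eq_ofReal_iff dist_nonneg (by positivity), Real.dist_eq, Real.dist_eq,
    abs_sub_comm t 1, abs_of_nonneg (sub_nonneg.2 ht.2)] at e1
  have f0 : (γ t - a) ^ 2 = t ^ 2 * (a - b) ^ 2 := by
    rw [← sq_abs, e0, mul_pow, sq_abs]
  have f1 : (γ t - b) ^ 2 = (1 - t) ^ 2 * (a - b) ^ 2 := by
    rw [← sq_abs, e1, mul_pow, sq_abs]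
  -- Stewart's identity: (γ - m)² = (1-t)(γ - a)² + t(γ - b)² - t(1-t)(a - b)² for m = (1-t)a + tb.
  -- It avoids all case distinctions on signs.
  have : (γ t - ((1 - t) * a + t * b)) ^ 2 = 0 := by
    linear_combination (1 - t) * f0 + t * f1
  linarith [pow_eq_zero_iff (two_ne_zero) |>.1 this]

theorem expWeight_ne_top {ψ : ℝ → EReal} {N : ℝ} (hN : N < 0) {x : ℝ} (hx : ψ x < ⊤) :
    expWeight ψ N x ≠ ∞ := by
  unfold expWeight
  rw [Ne, EReal.exp_eq_top_iff]
  induction h : ψ x with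
  | bot => simp [EReal.top_div_of_neg_ne_bot (show (N : EReal) < 0 by exact_mod_cast hN)
      (EReal.coe_ne_bot N)]
  | coe a => rw [← EReal.coe_neg, ← EReal.coe_div]; exact EReal.coe_ne_top _
  | top => exact absurd h hx.ne

theorem exp_neg_eq_expWeight_rpow {ψ : ℝ → EReal} {N : ℝ} (hN : N < 0) {x : ℝ} (hx : ψ x < ⊤) :
    EReal.exp (-(ψ x)) = expWeight ψ N x ^ N := by
  unfold expWeight
  induction h : ψ x with
  | bot => simp [EReal.top_div_of_neg_ne_bot (show (N : EReal) < 0 by exact_mod_cast hN)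
      (EReal.coe_ne_bot N), ENNReal.zero_rpow_of_neg hN]
  | coe a =>
    rw [← EReal.coe_neg, ← EReal.coe_div, EReal.exp_coe, EReal.exp_coe,
      ENNReal.ofReal_rpow_of_pos (Real.exp_pos _), ← Real.exp_mul, div_mul_cancel₀ _ hN.ne]
  | top => exact absurd h hx.ne

theorem expWeight_eq_zero_iff {ψ : ℝ → EReal} {N : ℝ} (hN : N < 0) {x : ℝ} (hx : ψ x < ⊤) :
    expWeight ψ N x = 0 ↔ ψ x = ⊥ := by
  unfold expWeight
  rw [EReal.exp_eq_zero_iff]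
  induction h : ψ x with
  | bot => simp [EReal.top_div_of_neg_ne_bot (show (N : EReal) < 0 by exact_mod_cast hN)
      (EReal.coe_ne_bot N)]
  | coe a => rw [← EReal.coe_neg, ← EReal.coe_div]; simp
  | top => exact absurd h hx.ne

/-- The geodesic from x to z is forced to be affine, so it passes through y at time (y-x)/(z-x);
clearing the denominator of σ gives the claim. -/
theorem IsKNConvex.isSturmConvex {K N : ℝ} (hN : N < 0) {ψ : ℝ → EReal} (hψ : ∀ x, ψ x < ⊤)
    (h : IsKNConvex K N ψ) : IsSturmConvex (K / N) fun x => (expWeight ψ N x).toReal := by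
  intro x y z hxy hyz hπ
  have hd : 0 < z - x := by linarith
  have hdist : dist x z = z - x := by rw [dist_comm, Real.dist_eq, abs_of_pos hd]
  have hS := gsin_pos hd hπ
  have hpi : 0 < Real.pi ^ 2 := by positivity
  obtain ⟨γ, hγ, hle⟩ := h x z (hψ x) (hψ z) (fun hK => by
    rw [hdist]
    refine lt_of_pow_lt_pow_left₀ 2 (by positivity) ?_
    rw [mul_pow, Real.sq_sqrt (div_pos_of_neg_of_neg hN hK).le]
    have := (div_mul_sq_lt_iff hN).1 hπ
    rw [mul_div_assoc', lt_div_iff_of_neg hK]; linarith)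
  have ht : (y - x) / (z - x) ∈ Icc (0 : ℝ) 1 :=
    ⟨div_nonneg (by linarith) hd.le, (div_le_one hd).2 (by linarith)⟩
  have hle := hle _ ht
  have hy : γ ((y - x) / (z - x)) = y := by
    rw [eq_lineMap_of_isGeodesic hγ ht]; field_simp; ring
  have h1 : (1 - (y - x) / (z - x)) * (z - x) = z - y := by field_simp; ring
  have h2 : (y - x) / (z - x) * (z - x) = y - x := by field_simp
  have hs1 := gsin_pos (sub_pos.2 hyz)
    (mul_sq_lt_of_le (sub_pos.2 hyz).le (by linarith : z - y ≤ z - x) hpi hπ)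
  have hs2 := gsin_pos (sub_pos.2 hxy)
    (mul_sq_lt_of_le (sub_pos.2 hxy).le (by linarith : y - x ≤ z - x) hpi hπ)
  rw [hy, hdist, sigma_eq_gsin hN hd ((div_mul_sq_lt_iff hN).1 hπ),
    sigma_eq_gsin hN hd ((div_mul_sq_lt_iff hN).1 hπ), h1, h2,
    ← ENNReal.ofReal_toReal (expWeight_ne_top hN (hψ x)),
    ← ENNReal.ofReal_toReal (expWeight_ne_top hN (hψ y)),
    ← ENNReal.ofReal_toReal (expWeight_ne_top hN (hψ z)),
    ← ENNReal.ofReal_mul (by positivity), ← ENNReal.ofReal_mul (by positivity),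
    ← ENNReal.ofReal_add (by positivity) (by positivity),
    ENNReal.ofReal_le_ofReal_iff (by positivity), div_mul_eq_mul_div, div_mul_eq_mul_div,
    ← add_div, le_div_iff₀ hS] at hle
  simpa [mul_comm] using hle

/-! ### Optimal transport on the line: comonotone couplings -/

theorem volume_setOf_lt_lt_lt (x y : ℝ) :
    2 * volume {q : ℝ × ℝ | x < q.1 ∧ q.1 < q.2 ∧ q.2 < y} = ENNReal.ofReal (y - x) ^ 2 := by
  have h1 : {q : ℝ × ℝ | x < q.1 ∧ q.1 < q.2 ∧ q.2 < y} =
      regionBetween (fun s => s) (fun _ => y) (Ioo x y) := by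
    ext q
    simp only [mem_ofPred_eq, regionBetween, mem_Ioo]
    constructor
    · rintro ⟨h1, h2, h3⟩; exact ⟨⟨h1, h2.trans h3⟩, h2, h3⟩
    · rintro ⟨⟨h1, -⟩, h2, h3⟩; exact ⟨h1, h2, h3⟩
  rcases le_or_gt y x with h | h
  · rw [h1, Ioo_eq_empty h.not_gt, ENNReal.ofReal_of_nonpos (by linarith)]
    simp [regionBetween]
  · have hint : IntegrableOn (fun s : ℝ => s) (Ioo x y) :=
      (continuous_id.integrableOn_Icc).mono_set Ioo_subset_Icc_self
    have hint' : IntegrableOn (fun _ : ℝ => y) (Ioo x y) :=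
      (continuous_const.integrableOn_Icc).mono_set Ioo_subset_Icc_self
    rw [h1, Measure.volume_eq_prod,
      volume_regionBetween_eq_integral hint hint' measurableSet_Ioo (fun s hs => hs.2.le),
      ← integral_Ioc_eq_integral_Ioo, ← intervalIntegral.integral_of_le h.le]
    simp only [Pi.sub_apply]
    rw [intervalIntegral.integral_sub (by simp) (by simp), integral_id,
      intervalIntegral.integral_const, ← ENNReal.ofReal_ofNat 2,
      ← ENNReal.ofReal_mul (by norm_num), ← ENNReal.ofReal_pow (by linarith)]
    congr 1
    simp only [smul_eq_mul]
    ring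

/-- The squared distance is twice the area of the triangle x < s < t < y; the second triangle covers
the opposite order, and at least one of the two is empty. This is a layer-cake formula for the
quadratic cost. -/
theorem edist_sq_eq_volume (x y : ℝ) :
    edist x y ^ 2 = 2 * (volume {q : ℝ × ℝ | x < q.1 ∧ q.1 < q.2 ∧ q.2 < y} +
      volume {q : ℝ × ℝ | y < q.1 ∧ q.1 < q.2 ∧ q.2 < x}) := by
  rw [mul_add, volume_setOf_lt_lt_lt, volume_setOf_lt_lt_lt, edist_dist, Real.dist_eq]
  rcases le_total x y with h | h
  · rw [abs_sub_comm, abs_of_nonneg (by linarith),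
      ENNReal.ofReal_of_nonpos (by linarith : x - y ≤ 0)]
    simp
  · rw [abs_of_nonneg (by linarith), ENNReal.ofReal_of_nonpos (by linarith : y - x ≤ 0)]
    simp

theorem measurableSet_setOf_lt_lt_lt {α : Type*} [MeasurableSpace α] {a b c d : α → ℝ}
    (ha : Measurable a) (hb : Measurable b) (hc : Measurable c) (hd : Measurable d) :
    MeasurableSet {z | a z < b z ∧ b z < c z ∧ c z < d z} :=
  (measurableSet_lt ha hb).inter ((measurableSet_lt hb hc).inter (measurableSet_lt hc hd))

/-- A representation of the quadratic cost by the masses of quadrants. -/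
theorem transportCost_eq_lintegral (π : Measure (ℝ × ℝ)) [SFinite π] :
    transportCost π = 2 * ∫⁻ q : ℝ × ℝ, {q | q.1 < q.2}.indicator
      (fun q => π {p | p.1 < q.1 ∧ q.2 < p.2} + π {p | p.2 < q.1 ∧ q.2 < p.1}) q := by
  have hA : MeasurableSet {z : (ℝ × ℝ) × (ℝ × ℝ) | z.1.1 < z.2.1 ∧ z.2.1 < z.2.2 ∧ z.2.2 < z.1.2} :=
    measurableSet_setOf_lt_lt_lt (by fun_prop) (by fun_prop) (by fun_prop) (by fun_prop)
  have hB : MeasurableSet {z : (ℝ × ℝ) × (ℝ × ℝ) | z.1.2 < z.2.1 ∧ z.2.1 < z.2.2 ∧ z.2.2 < z.1.1} :=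
    measurableSet_setOf_lt_lt_lt (by fun_prop) (by fun_prop) (by fun_prop) (by fun_prop)
  -- Tonelli: integrating triangle areas against π is integrating the π-masses of quadrants over the
  -- points (s,t) with s < t.
  have hA' := (Measure.prod_apply (μ := π) (ν := (volume : Measure (ℝ × ℝ))) hA).symm.trans
    (Measure.prod_apply_symm hA)
  have hB' := (Measure.prod_apply (μ := π) (ν := (volume : Measure (ℝ × ℝ))) hB).symm.trans
    (Measure.prod_apply_symm hB)
  simp only [transportCost, edist_sq_eq_volume]
  rw [lintegral_const_mul' _ _ (by simp)]
  refine congrArg (2 * ·) ((lintegral_add_left (measurable_measure_prodMk_left hA) _).trans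
    ((congrArg₂ (· + ·) hA' hB').trans ?_))
  rw [← lintegral_add_left (measurable_measure_prodMk_right hA)]
  refine lintegral_congr fun q => ?_
  by_cases hq : q.1 < q.2 <;> simp [hq, preimage]

/-- The transport between two functions of one variable is monotone. -/
def Comonotone {Ω : Type*} (I : Set Ω) (X Y : Ω → ℝ) : Prop :=
  ∀ u ∈ I, ∀ v ∈ I, X u < X v → Y u ≤ Y v

theorem Comonotone.symm {Ω : Type*} {I : Set Ω} {X Y : Ω → ℝ} (h : Comonotone I X Y) :
    Comonotone I Y X := fun u hu v hv huv => by
  by_contra! hc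
  exact absurd (h v hv u hu hc) huv.not_ge

/-- The right-hand side is the Fréchet–Hoeffding lower bound, truncated at 0. A point u of the
quadrant forces {Y ≤ t} ⊆ {X < s} almost everywhere, since X v ≥ s > X u would give Y v ≥ Y u > t;
if no such point exists, the mass is 0. -/
theorem Comonotone.measure_le {Ω : Type*} [MeasurableSpace Ω] {lam : Measure Ω}
    [IsFiniteMeasure lam] {I : Set Ω} (hI : ∀ᵐ u ∂lam, u ∈ I) {X Y : Ω → ℝ}
    (hY : Measurable Y) (h : Comonotone I X Y) (s t : ℝ) :
    lam {u | X u < s ∧ t < Y u} ≤ lam {u | X u < s} - lam {u | Y u ≤ t} := by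
  by_cases hst : ∃ u ∈ I, X u < s ∧ t < Y u
  · obtain ⟨u, hu, hus, hut⟩ := hst
    have hsub : {v | Y v ≤ t} ≤ᵐ[lam] {v | X v < s} := by
      filter_upwards [hI] with v hv (hvt : Y v ≤ t)
      by_contra hc
      have hc : s ≤ X v := not_lt.1 hc
      exact absurd (h u hu v hv (hus.trans_le hc)) (by linarith)
    have hm : MeasurableSet {v | Y v ≤ t} := measurableSet_le hY measurable_const
    have hunion : lam ({v | X v < s} ∪ {v | Y v ≤ t}) = lam {v | X v < s} := by
      refine measure_congr ?_
      filter_upwards [hsub] with v hv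
      exact propext ⟨fun hw => hw.elim id hv, Or.inl⟩
    rw [← hunion, ← measure_sdiff' _ hm.nullMeasurableSet (measure_ne_top _ _)]
    exact measure_mono fun v hv => ⟨hv.1, hv.2.not_ge⟩
  · push Not at hst
    have : lam {u | X u < s ∧ t < Y u} = 0 := by
      refine measure_eq_zero_iff_ae_notMem.2 ?_
      filter_upwards [hI] with u hu hc
      exact absurd hc.2 (hst u hu hc.1).not_gt
    simp [this]

/-- Comonotone couplings minimise the quadratic cost. -/
theorem Comonotone.transportCost_le {Ω : Type*} [MeasurableSpace Ω] {lam : Measure Ω}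
    [IsFiniteMeasure lam] {I : Set Ω} (hI : ∀ᵐ u ∂lam, u ∈ I) {X Y : Ω → ℝ} (hX : Measurable X)
    (hY : Measurable Y) (h : Comonotone I X Y) {π : Measure (ℝ × ℝ)}
    (hπ : π ∈ couplings (lam.map X) (lam.map Y)) :
    transportCost (lam.map fun u => (X u, Y u)) ≤ transportCost π := by
  have hfin : IsFiniteMeasure π := by
    have : IsFiniteMeasure (π.map Prod.fst) := hπ.1 ▸ inferInstance
    exact Measure.isFiniteMeasure_of_map measurable_fst.aemeasurable
  have hfst : ∀ A, MeasurableSet A → π (Prod.fst ⁻¹' A) = lam (X ⁻¹' A) := fun A hA => by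
    rw [← Measure.map_apply measurable_fst hA, hπ.1, Measure.map_apply hX hA]
  have hsnd : ∀ A, MeasurableSet A → π (Prod.snd ⁻¹' A) = lam (Y ⁻¹' A) := fun A hA => by
    rw [← Measure.map_apply measurable_snd hA, hπ.2, Measure.map_apply hY hA]
  have hXY : Measurable fun u => (X u, Y u) := hX.prodMk hY
  rw [transportCost_eq_lintegral, transportCost_eq_lintegral]
  -- The comparison holds quadrant by quadrant: every coupling has π{x < s, t < y} ≥ π{x < s} - π{y
  -- ≤ t}, and comonotone couplings attain the least value. No finiteness of the cost is needed.
  suffices key : ∀ q : ℝ × ℝ, lam.map (fun u => (X u, Y u)) {p | p.1 < q.1 ∧ q.2 < p.2} +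
      lam.map (fun u => (X u, Y u)) {p | p.2 < q.1 ∧ q.2 < p.1} ≤
        π {p | p.1 < q.1 ∧ q.2 < p.2} + π {p | p.2 < q.1 ∧ q.2 < p.1} from
    mul_le_mul' le_rfl (lintegral_mono fun q => indicator_le_indicator (key q))
  refine fun q => add_le_add ?_ ?_
  · have hm : MeasurableSet {p : ℝ × ℝ | p.1 < q.1 ∧ q.2 < p.2} :=
      (measurableSet_lt measurable_fst measurable_const).inter
        (measurableSet_lt measurable_const measurable_snd)
    refine (Measure.map_apply hXY hm).trans_le ((h.measure_le hI hY q.1 q.2).trans ?_)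
    have e1 : lam {u | X u < q.1} = π {p | p.1 < q.1} := (hfst (Iio q.1) measurableSet_Iio).symm
    have e2 : lam {u | Y u ≤ q.2} = π {p | p.2 ≤ q.2} := (hsnd (Iic q.2) measurableSet_Iic).symm
    rw [e1, e2]
    refine (le_measure_sdiff).trans_eq ?_
    congr 1; ext p; simp
  · have hm : MeasurableSet {p : ℝ × ℝ | p.2 < q.1 ∧ q.2 < p.1} :=
      (measurableSet_lt measurable_snd measurable_const).inter
        (measurableSet_lt measurable_const measurable_fst)
    refine (Measure.map_apply hXY hm).trans_le ((h.symm.measure_le hI hX q.1 q.2).trans ?_)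
    have e1 : lam {u | X u ≤ q.2} = π {p | p.1 ≤ q.2} := (hfst (Iic q.2) measurableSet_Iic).symm
    have e2 : lam {u | Y u < q.1} = π {p | p.2 < q.1} := (hsnd (Iio q.1) measurableSet_Iio).symm
    rw [e1, e2]
    refine (le_measure_sdiff).trans_eq ?_
    congr 1; ext p; simp

theorem map_prodMk_mem_couplings {Ω : Type*} [MeasurableSpace Ω] (lam : Measure Ω)
    {X Y : Ω → ℝ} (hX : Measurable X) (hY : Measurable Y) :
    lam.map (fun u => (X u, Y u)) ∈ couplings (lam.map X) (lam.map Y) :=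
  ⟨by rw [Measure.map_map measurable_fst (hX.prodMk hY)]; rfl,
    by rw [Measure.map_map measurable_snd (hX.prodMk hY)]; rfl⟩

theorem transportCost_map {Ω : Type*} [MeasurableSpace Ω] (lam : Measure Ω)
    {X Y : Ω → ℝ} (hX : Measurable X) (hY : Measurable Y) :
    transportCost (lam.map fun u => (X u, Y u)) = ∫⁻ u, edist (X u) (Y u) ^ 2 ∂lam :=
  lintegral_map (f := fun p : ℝ × ℝ => edist p.1 p.2 ^ 2) (by fun_prop) (hX.prodMk hY)

theorem Comonotone.W2_eq {Ω : Type*} [MeasurableSpace Ω] {lam : Measure Ω}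
    [IsFiniteMeasure lam] {I : Set Ω} (hI : ∀ᵐ u ∂lam, u ∈ I) {X Y : Ω → ℝ} (hX : Measurable X)
    (hY : Measurable Y) (h : Comonotone I X Y) :
    W2 (lam.map X) (lam.map Y) = (∫⁻ u, edist (X u) (Y u) ^ 2 ∂lam) ^ (1 / 2 : ℝ) := by
  rw [W2, ← transportCost_map lam hX hY]
  congr 1
  exact le_antisymm (iInf₂_le _ (map_prodMk_mem_couplings lam hX hY))
    (le_iInf₂ fun π hπ => h.transportCost_le hI hX hY hπ)

theorem Comonotone.mem_optimalCouplings {Ω : Type*} [MeasurableSpace Ω] {lam : Measure Ω}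
    [IsFiniteMeasure lam] {I : Set Ω} (hI : ∀ᵐ u ∂lam, u ∈ I) {X Y : Ω → ℝ} (hX : Measurable X)
    (hY : Measurable Y) (h : Comonotone I X Y) :
    lam.map (fun u => (X u, Y u)) ∈ optimalCouplings (lam.map X) (lam.map Y) := by
  refine ⟨map_prodMk_mem_couplings lam hX hY, ?_⟩
  rw [h.W2_eq hI hX hY, transportCost_map lam hX hY, ← ENNReal.rpow_natCast, ← ENNReal.rpow_mul]
  norm_num

/-! ### Displacement interpolation -/

/-- Linear interpolation of two functions. -/
def displacement {Ω : Type*} (X Y : Ω → ℝ) (t : ℝ) (u : Ω) : ℝ := (1 - t) * X u + t * Y u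

theorem displacement_zero {Ω : Type*} (X Y : Ω → ℝ) : displacement X Y 0 = X := by
  ext u; simp [displacement]

theorem displacement_one {Ω : Type*} (X Y : Ω → ℝ) : displacement X Y 1 = Y := by
  ext u; simp [displacement]

theorem measurable_displacement {Ω : Type*} [MeasurableSpace Ω] {X Y : Ω → ℝ}
    (hX : Measurable X) (hY : Measurable Y) (t : ℝ) : Measurable (displacement X Y t) := by
  unfold displacement; fun_prop

theorem monotoneOn_displacement {I : Set ℝ} {X Y : ℝ → ℝ} (hX : MonotoneOn X I)
    (hY : MonotoneOn Y I) {t : ℝ} (ht : t ∈ Icc (0 : ℝ) 1) :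
    MonotoneOn (displacement X Y t) I := fun _ hu _ hv huv =>
  add_le_add (mul_le_mul_of_nonneg_left (hX hu hv huv) (sub_nonneg.2 ht.2))
    (mul_le_mul_of_nonneg_left (hY hu hv huv) ht.1)

theorem comonotone_of_monotoneOn {I : Set ℝ} {X Y : ℝ → ℝ} (hX : MonotoneOn X I)
    (hY : MonotoneOn Y I) : Comonotone I X Y := fun _ hu _ hv huv =>
  hY hu hv (by
    by_contra! hc
    exact absurd (hX hv hu hc.le) huv.not_ge)

/-- Displacement interpolation of monotone functions is a geodesic for `W2`. -/
theorem isGeodesic_map_displacement {lam : Measure ℝ} [IsFiniteMeasure lam] {I : Set ℝ}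
    (hI : ∀ᵐ u ∂lam, u ∈ I) {X Y : ℝ → ℝ} (hX : Measurable X) (hY : Measurable Y)
    (hXI : MonotoneOn X I) (hYI : MonotoneOn Y I) :
    IsGeodesic W2 (fun t => lam.map (displacement X Y t)) (lam.map X) (lam.map Y) := by
  refine ⟨by simp only [displacement_zero], by simp only [displacement_one],
    fun s hs t ht => ?_⟩
  -- The interpolants at times s and t are themselves comonotone, so W₂ is computed exactly by the
  -- pointwise distance |s-t| |X-Y|.
  rw [(comonotone_of_monotoneOn (monotoneOn_displacement hXI hYI hs)
      (monotoneOn_displacement hXI hYI ht)).W2_eq hI (measurable_displacement hX hY s)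
      (measurable_displacement hX hY t),
    (comonotone_of_monotoneOn hXI hYI).W2_eq hI hX hY]
  have : ∀ u, edist (displacement X Y s u) (displacement X Y t u) ^ 2 =
      ENNReal.ofReal |s - t| ^ 2 * edist (X u) (Y u) ^ 2 := by
    intro u
    rw [← mul_pow, edist_dist, edist_dist, ← ENNReal.ofReal_mul (abs_nonneg _), Real.dist_eq,
      Real.dist_eq, ← abs_mul, displacement, displacement, abs_sub_comm]
    congr 3
    ring
  simp_rw [this]
  rw [lintegral_const_mul' _ _ (by finiteness), ENNReal.mul_rpow_of_nonneg _ _ (by norm_num),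
    ← ENNReal.rpow_natCast, ← ENNReal.rpow_mul]
  norm_num

theorem isP2_map_displacement {lam : Measure ℝ} [IsProbabilityMeasure lam] {X Y : ℝ → ℝ}
    (hX : Measurable X) (hY : Measurable Y) (h0 : IsP2 (lam.map X)) (h1 : IsP2 (lam.map Y))
    {t : ℝ} (ht : t ∈ Icc (0 : ℝ) 1) : IsP2 (lam.map (displacement X Y t)) := by
  refine ⟨Measure.isProbabilityMeasure_map (measurable_displacement hX hY t).aemeasurable, ?_⟩
  obtain ⟨-, a, ha⟩ := h0
  obtain ⟨-, b, hb⟩ := h1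
  rw [lintegral_map (by fun_prop) hX] at ha
  rw [lintegral_map (by fun_prop) hY] at hb
  refine ⟨(1 - t) * a + t * b, ?_⟩
  rw [lintegral_map (by fun_prop) (measurable_displacement hX hY t)]
  refine lt_of_le_of_lt (b := ∫⁻ u, 2 * (edist (X u) a ^ 2 + edist (Y u) b ^ 2) ∂lam) ?_ ?_
  · refine lintegral_mono fun u => ?_
    simp only [edist_dist, Real.dist_eq]
    rw [← ENNReal.ofReal_pow (abs_nonneg _), ← ENNReal.ofReal_pow (abs_nonneg _),
      ← ENNReal.ofReal_pow (abs_nonneg _), ← ENNReal.ofReal_add (by positivity) (by positivity),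
      ← ENNReal.ofReal_ofNat 2, ← ENNReal.ofReal_mul (by norm_num)]
    refine ENNReal.ofReal_le_ofReal ?_
    rw [sq_abs, sq_abs, sq_abs, displacement]
    have h1t := sub_nonneg.2 ht.2
    set p := X u - a
    set q := Y u - b
    rw [show (1 - t) * X u + t * Y u - ((1 - t) * a + t * b) = (1 - t) * p + t * q by ring]
    nlinarith [mul_nonneg (mul_nonneg ht.1 h1t) (sq_nonneg (p - q)), sq_nonneg p, sq_nonneg q,
      mul_nonneg ht.1 (sq_nonneg p), mul_nonneg h1t (sq_nonneg q)]
  · rw [lintegral_const_mul' _ _ (by simp), lintegral_add_left (by fun_prop)]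
    exact ENNReal.mul_lt_top (by simp) (ENNReal.add_lt_top.2 ⟨ha, hb⟩)

/-! ### Quantile functions -/

open ProbabilityTheory in
/-- The quantile function of a probability measure on the line. -/
theorem exists_quantile (μ : Measure ℝ) [IsProbabilityMeasure μ] :
    ∃ X : ℝ → ℝ, Measurable X ∧ MonotoneOn X (Ioo 0 1) ∧
      (volume.restrict (Ioo (0 : ℝ) 1)).map X = μ := by
  set F := cdf μ
  -- The generalised inverse of the distribution function F, set to 0 off (0,1) for global
  -- measurability. Right continuity of F gives the Galois connection X u ≤ x ↔ u ≤ F x, from which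
  -- everything else follows.
  set X : ℝ → ℝ := (Ioo (0 : ℝ) 1).indicator fun u => sInf {x | u ≤ F x}
  have hgal : ∀ u ∈ Ioo (0 : ℝ) 1, ∀ x, X u ≤ x ↔ u ≤ F x := by
    intro u hu x
    have hne : {x | u ≤ F x}.Nonempty :=
      (((tendsto_cdf_atTop μ).eventually_const_lt hu.2).mono fun y hy => hy.le).exists
    have hbd : BddBelow {x | u ≤ F x} := by
      obtain ⟨y, hy⟩ := ((tendsto_cdf_atBot μ).eventually_lt_const hu.1).exists
      refine ⟨y, fun z (hz : u ≤ F z) => ?_⟩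
      by_contra! hc
      exact absurd (hz.trans (F.mono hc.le)) hy.not_ge
    simp only [X, indicator_of_mem hu]
    refine ⟨fun h => ?_, fun h => csInf_le hbd h⟩
    have hlim : Tendsto F (𝓝[>] x) (𝓝 (F x)) :=
      (F.right_continuous x).tendsto.mono_left (nhdsWithin_mono _ Ioi_subset_Ici_self)
    refine ge_of_tendsto hlim ?_
    filter_upwards [self_mem_nhdsWithin] with y hy
    obtain ⟨z, hz, hzy⟩ := exists_lt_of_csInf_lt hne (h.trans_lt hy)
    exact le_trans hz (F.mono hzy.le)
  have hmeas : Measurable X := by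
    refine measurable_of_Iic fun x => ?_
    have : X ⁻¹' Iic x = (Ioo 0 1 ∩ Iic (F x)) ∪ ((Ioo 0 1)ᶜ ∩ {_u | 0 ≤ x}) := by
      ext u
      by_cases hu : u ∈ Ioo (0 : ℝ) 1
      · simp only [mem_preimage, mem_Iic, hgal u hu, mem_union, mem_inter_iff, mem_compl_iff, hu]
        simp
      · simp only [mem_preimage, mem_Iic, X, indicator_of_notMem hu, mem_union, mem_inter_iff,
          mem_compl_iff, hu]
        simp
    rw [this]
    exact (measurableSet_Ioo.inter measurableSet_Iic).union
      (measurableSet_Ioo.compl.inter (MeasurableSet.const _))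
  refine ⟨X, hmeas, fun u hu v hv huv => (hgal u hu _).2 (huv.trans ((hgal v hv _).1 le_rfl)), ?_⟩
  have hprob : IsFiniteMeasure ((volume.restrict (Ioo (0 : ℝ) 1)).map X) := inferInstance
  refine Measure.ext_of_Iic _ _ fun x => ?_
  rw [Measure.map_apply hmeas measurableSet_Iic,
    Measure.restrict_apply (hmeas measurableSet_Iic), ← ofReal_cdf]
  have hset : X ⁻¹' Iic x ∩ Ioo 0 1 = Ioo 0 1 ∩ Iic (F x) := by
    ext u
    constructor
    · rintro ⟨h1, h2⟩; exact ⟨h2, (hgal u h2 x).1 h1⟩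
    · rintro ⟨h1, h2⟩; exact ⟨(hgal u h1 x).2 h2, h1⟩
  rw [hset]
  refine le_antisymm ((measure_mono (t := Ioc 0 (F x)) fun u hu => ⟨hu.1.1, hu.2⟩).trans_eq
    (by simp [F])) (le_trans (by simp [F]) (measure_mono (s := Ioo 0 (F x)) fun u hu =>
      ⟨⟨hu.1, hu.2.trans_le (cdf_le_one μ x)⟩, hu.2.le⟩))

/-! ### Change of variables for monotone maps -/

theorem absolutelyContinuous_map_of_deriv_pos {D : Set ℝ} (hD : MeasurableSet D) {X X' : ℝ → ℝ}
    (hX : Measurable X) (hX' : Measurable X')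
    (hderiv : ∀ u ∈ D, HasDerivWithinAt X (X' u) D u) (hpos : ∀ u ∈ D, 0 < X' u)
    (hinj : InjOn X D) : (volume.restrict D).map X ≪ volume := by
  refine Measure.AbsolutelyContinuous.mk fun E hE hE0 => ?_
  rw [Measure.map_apply hX hE, Measure.restrict_apply (hX hE)]
  set A := X ⁻¹' E ∩ D
  have hA : MeasurableSet A := (hX hE).inter hD
  -- The image of A has measure ∫_A |X'|. It lies in the null set E, and X' > 0 on A, so A is null.
  have h := lintegral_image_eq_lintegral_abs_deriv_mul hA
    (fun u hu => (hderiv u hu.2).mono inter_subset_right) (hinj.mono inter_subset_right)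
    (fun _ => 1)
  have h0 : volume (X '' A) = 0 := measure_mono_null (by rintro _ ⟨u, hu, rfl⟩; exact hu.1) hE0
  simp only [lintegral_const, Measure.restrict_apply MeasurableSet.univ, univ_inter, one_mul, h0,
    mul_one] at h
  have h2 := (lintegral_eq_zero_iff (by fun_prop)).1 h.symm
  have h3 : ∀ᵐ u ∂volume.restrict A, u ∈ A := ae_restrict_mem hA
  have h4 : ∀ᵐ u ∂volume.restrict A, False := by
    filter_upwards [h2, h3] with u hu huA
    have := hpos u huA.2
    simp only [Pi.zero_apply, ENNReal.ofReal_eq_zero] at hu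
    exact absurd this (by linarith [le_abs_self (X' u)])
  simpa using h4

/-- Change of variables for the density of an image measure. -/
theorem ae_mul_density_eq_one {D : Set ℝ} (hD : MeasurableSet D) {X X' : ℝ → ℝ}
    (hX : Measurable X) (hX' : Measurable X')
    (hderiv : ∀ u ∈ D, HasDerivWithinAt X (X' u) D u) (hpos : ∀ u ∈ D, 0 < X' u)
    (hinj : InjOn X D) {ρ : ℝ → ℝ≥0∞} (hρ : Measurable ρ)
    (hmap : (volume.restrict D).map X = volume.withDensity ρ) :
    ∀ᵐ u ∂volume.restrict D, ENNReal.ofReal (X' u) * ρ (X u) = 1 := by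
  refine ae_eq_of_forall_setLIntegral_eq_of_sigmaFinite (g := fun _ => 1) (by fun_prop)
    (by fun_prop) fun s hs _ => ?_
  rw [Measure.restrict_restrict hs]
  have hA : MeasurableSet (s ∩ D) := hs.inter hD
  have hinjA : InjOn X (s ∩ D) := hinj.mono inter_subset_right
  have hXA : MeasurableSet (X '' (s ∩ D)) := hA.image_of_measurable_injOn hX hinjA
  have h := lintegral_image_eq_lintegral_abs_deriv_mul hA
    (fun u hu => (hderiv u hu.2).mono inter_subset_right) hinjA ρ
  rw [← withDensity_apply _ hXA, ← hmap, Measure.map_apply hX hXA,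
    Measure.restrict_apply (hX hXA)] at h
  -- Injectivity makes the mass of X(s ∩ D) under the image measure equal to the length of s ∩ D, so
  -- the two integrands have equal integrals over every s.
  have hset : X ⁻¹' (X '' (s ∩ D)) ∩ D = s ∩ D := by
    ext u
    constructor
    · rintro ⟨⟨v, hv, hvu⟩, hu⟩
      rwa [← hinj hv.2 hu hvu]
    · exact fun hu => ⟨mem_image_of_mem X hu, hu.2⟩
  rw [hset] at h
  rw [setLIntegral_one, h]
  refine setLIntegral_congr_fun hA fun u hu => ?_
  simp only [abs_of_pos (hpos u hu.2)]

/-- A monotone function is differentiable almost everywhere, and by Sard's lemma the image of its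
critical set Z is null. Absolute continuity of the image measure then makes Z null. -/
theorem ae_deriv_pos_of_monotoneOn {I : Set ℝ} (hI : IsOpen I) {X : ℝ → ℝ} (hX : Measurable X)
    (hmono : MonotoneOn X I) (hac : (volume.restrict I).map X ≪ volume) :
    ∀ᵐ u ∂volume.restrict I, DifferentiableAt ℝ X u ∧ 0 < deriv X u := by
  have hdiff : ∀ᵐ u ∂volume.restrict I, DifferentiableAt ℝ X u := by
    filter_upwards [hmono.ae_differentiableWithinAt hI.measurableSet,
      ae_restrict_mem hI.measurableSet] with u hu huI
    exact hu.differentiableAt (hI.mem_nhds huI)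
  set Z := {u | u ∈ I ∧ DifferentiableAt ℝ X u ∧ deriv X u = 0}
  have hZ : volume (X '' Z) = 0 := by
    refine addHaar_image_eq_zero_of_det_fderivWithin_eq_zero volume
      (f' := fun u => ContinuousLinearMap.toSpanSingleton ℝ (deriv X u))
      (fun u hu => hu.2.1.hasDerivAt.hasFDerivAt.hasFDerivWithinAt) fun u hu => ?_
    rw [hu.2.2]
    simp
  have hZ0 : ∀ᵐ u ∂volume.restrict I, u ∉ Z := by
    have h1 := hac (measure_toMeasurable (μ := volume) (X '' Z) ▸ hZ :
      volume (toMeasurable volume (X '' Z)) = 0)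
    rw [Measure.map_apply hX (measurableSet_toMeasurable _ _)] at h1
    exact measure_eq_zero_iff_ae_notMem.1
      (measure_mono_null (t := X ⁻¹' toMeasurable volume (X '' Z))
        (fun u hu => subset_toMeasurable _ _ (mem_image_of_mem X hu)) h1)
  filter_upwards [hdiff, hZ0, ae_restrict_mem hI.measurableSet] with u hu huZ huI
  refine ⟨hu, lt_of_le_of_ne ?_ fun h => huZ ⟨huI, hu, h.symm⟩⟩
  rw [← hu.hasDerivAt.hasDerivWithinAt.derivWithin (hI.uniqueDiffWithinAt (𝕜 := ℝ) huI)]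
  exact hmono.derivWithin_nonneg

/-- Equal values at u < v would make the monotone X constant on [u,v], forcing a zero one-sided
derivative at u. -/
theorem injOn_of_monotoneOn_of_deriv_pos {I D : Set ℝ} (hI : OrdConnected I) (hDI : D ⊆ I)
    {X X' : ℝ → ℝ} (hmono : MonotoneOn X I) (hderiv : ∀ u ∈ D, HasDerivAt X (X' u) u)
    (hpos : ∀ u ∈ D, 0 < X' u) : InjOn X D := by
  have key : ∀ u ∈ D, ∀ v ∈ D, u < v → X u ≠ X v := by
    intro u hu v hv huv heq
    have hconst : ∀ w ∈ Icc u v, X w = X u := fun w hw =>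
      have hwI := hI.out (hDI hu) (hDI hv) hw
      le_antisymm ((hmono hwI (hDI hv) hw.2).trans_eq heq.symm) (hmono (hDI hu) hwI hw.1)
    have h1 : HasDerivWithinAt X 0 (Icc u v) u :=
      (hasDerivWithinAt_const u _ (X u)).congr hconst rfl
    have h2 := (hderiv u hu).hasDerivWithinAt (s := Icc u v)
    have := (uniqueDiffOn_Icc huv u ⟨le_rfl, huv.le⟩).eq_deriv _ h1 h2
    exact (hpos u hu).ne this
  intro u hu v hv h
  rcases lt_trichotomy u v with h' | h' | h'
  · exact absurd h (key u hu v hv h')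
  · exact h'
  · exact absurd h.symm (key v hv u hu h')

/-! ### The pointwise inequality -/

theorem rpow_one_sub_mul_rpow_add_le {p A B c d : ℝ} (hp : 1 ≤ p) (hA : 0 < A) (hB : 0 < B)
    (hc : 0 ≤ c) (hd : 0 ≤ d) :
    (A + B) ^ (1 - p) * (c + d) ^ p ≤ A ^ (1 - p) * c ^ p + B ^ (1 - p) * d ^ p := by
  have hAB : 0 < A + B := by linarith
  -- Convexity of x^p at c/A and d/B with weights A/(A+B) and B/(A+B).
  have h := (convexOn_rpow hp).2 (mem_Ici.2 (div_nonneg hc hA.le))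
    (mem_Ici.2 (div_nonneg hd hB.le)) (by positivity : 0 ≤ A / (A + B))
    (by positivity : 0 ≤ B / (A + B)) (by field_simp)
  simp only [smul_eq_mul] at h
  rw [show A / (A + B) * (c / A) + B / (A + B) * (d / B) = (c + d) / (A + B) by field_simp,
    Real.div_rpow (by linarith) hAB.le, Real.div_rpow hc hA.le, Real.div_rpow hd hB.le] at h
  rw [Real.rpow_sub hAB, Real.rpow_sub hA, Real.rpow_sub hB, Real.rpow_one, Real.rpow_one,
    Real.rpow_one]
  have := mul_le_mul_of_nonneg_left h hAB.le
  calc _ = (A + B) * ((c + d) ^ p / (A + B) ^ p) := by ring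
    _ ≤ _ := this
    _ = _ := by field_simp

theorem measurable_sigma (K N t : ℝ) : Measurable (sigma K N t) := by
  unfold sigma
  refine Measurable.ite (measurableSet_le (by fun_prop) (by fun_prop)) (by fun_prop) ?_
  refine Measurable.ite (measurableSet_lt (by fun_prop) (by fun_prop)) (by fun_prop) ?_
  exact Measurable.ite (measurableSet_eq_fun (by fun_prop) (by fun_prop)) (by fun_prop)
    (by fun_prop)

theorem measurable_tau (K N t : ℝ) : Measurable (tau K N t) :=
  ((measurable_sigma K (N - 1) t).pow_const _).const_mul _

theorem tau_eq_top {K n t θ : ℝ} (hn : n < 0) (h : K * θ ^ 2 ≤ (n - 1) * Real.pi ^ 2) :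
    tau K n t θ = ∞ := by
  have hp : 0 < (n - 1) / n := div_pos_of_neg_of_neg (by linarith) hn
  rw [tau, sigma_eq_top t h, ENNReal.top_rpow_of_pos hp, ENNReal.mul_top]
  exact fun h0 => by
    rcases ENNReal.rpow_eq_zero_iff.1 h0 with h1 | h1
    · exact absurd h1.2 (by simpa using hn.le)
    · exact absurd h1.1 ENNReal.ofReal_ne_top

theorem tau_eq_ofReal {K n t θ s : ℝ} (ht : 0 < t) (hs : 0 < s)
    (h : sigma K (n - 1) t θ = ENNReal.ofReal s) :
    tau K n t θ = ENNReal.ofReal (t ^ (1 / n) * s ^ ((n - 1) / n)) := by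
  rw [tau, h, ENNReal.ofReal_rpow_of_pos ht, ENNReal.ofReal_rpow_of_pos hs,
    ENNReal.ofReal_mul (by positivity)]

theorem one_le_tau_one {K n θ : ℝ} (hn : n < 0) (hθ : 0 ≤ θ) : 1 ≤ tau K n 1 θ := by
  rcases le_or_gt (K * θ ^ 2) ((n - 1) * Real.pi ^ 2) with h | h
  · rw [tau_eq_top hn h]; exact le_top
  · have hs : sigma K (n - 1) 1 θ = ENNReal.ofReal 1 := by
      rcases hθ.eq_or_lt with h0 | h0
      · rw [← h0, sigma_zero_right (by linarith)]
      · have hg := gsin_pos h0 ((div_mul_sq_lt_iff (by linarith)).2 h)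
        rw [sigma_eq_gsin (by linarith) h0 h, one_mul, div_self hg.ne']
    rw [tau_eq_ofReal one_pos one_pos hs]
    simp

/-- Sturm convexity of `g` gives the inequality for `g ^ (N / M)` with the distortion
coefficients of any larger dimension `M < 0`. -/
theorem IsSturmConvex.exists_sigma {K N M t x z : ℝ} {g : ℝ → ℝ} (hNM : N ≤ M) (hM : M < 0)
    (hg : IsSturmConvex (K / N) g) (hg0 : ∀ y, 0 ≤ g y) (ht : t ∈ Ioo (0 : ℝ) 1)
    (hx : 0 < g x) (hz : 0 < g z) (h : M * Real.pi ^ 2 < K * dist x z ^ 2) :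
    ∃ s₀ > 0, ∃ s₁ > 0, sigma K M (1 - t) (dist x z) = ENNReal.ofReal s₀ ∧
      sigma K M t (dist x z) = ENNReal.ofReal s₁ ∧
      g ((1 - t) * x + t * z) ^ (N / M) ≤ s₀ * g x ^ (N / M) + s₁ * g z ^ (N / M) := by
  have hN : N < 0 := by linarith
  have hα : 1 ≤ N / M := (one_le_div_of_neg hM).2 hNM
  have hκ : N / M * (K / N) = K / M := by
    have := hN.ne
    field_simp
  have hpi : 0 < Real.pi ^ 2 := by positivity
  have key : ∀ {a b τ : ℝ}, a < b → τ ∈ Ioo (0 : ℝ) 1 → 0 < g a → 0 < g b →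
      M * Real.pi ^ 2 < K * (b - a) ^ 2 →
      ∃ s₀ > 0, ∃ s₁ > 0, sigma K M (1 - τ) (b - a) = ENNReal.ofReal s₀ ∧
        sigma K M τ (b - a) = ENNReal.ofReal s₁ ∧
        g ((1 - τ) * a + τ * b) ^ (N / M) ≤ s₀ * g a ^ (N / M) + s₁ * g b ^ (N / M) := by
    intro a b τ hab hτ ha hb hd
    have hd0 := sub_pos.2 hab
    have hd' := (div_mul_sq_lt_iff hM).2 hd
    have hS := gsin_pos hd0 hd'
    have hτ1 := sub_pos.2 hτ.2
    have hsub : ∀ r ∈ Ioo (0 : ℝ) 1, 0 < gsin (K / M) (r * (b - a)) := fun r hr =>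
      gsin_pos (mul_pos hr.1 hd0) (mul_sq_lt_of_le (mul_pos hr.1 hd0).le
        (by nlinarith [hr.2]) hpi hd')
    refine ⟨_, div_pos (hsub (1 - τ) ⟨hτ1, by linarith [hτ.1]⟩) hS, _, div_pos (hsub τ hτ) hS,
      sigma_eq_gsin hM hd0 hd, sigma_eq_gsin hM hd0 hd, ?_⟩
    have := hg.rpow_le hα hab hτ ha hb hg0 (by rwa [hκ])
    rwa [hκ] at this
  rcases lt_trichotomy x z with hxz | hxz | hxz
  · have hdist : dist x z = z - x := by
      rw [dist_comm, Real.dist_eq, abs_of_pos (sub_pos.2 hxz)]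
    rw [hdist] at h ⊢
    exact key hxz ht hx hz h
  · subst hxz
    refine ⟨1 - t, sub_pos.2 ht.2, t, ht.1, by rw [dist_self, sigma_zero_right hM],
      by rw [dist_self, sigma_zero_right hM], ?_⟩
    rw [← add_mul, ← add_mul, sub_add_cancel, one_mul, one_mul]
  -- The case z < x is the case x < z with the endpoints exchanged and t replaced by 1 - t.
  · have hdist : dist x z = x - z := by rw [Real.dist_eq, abs_of_pos (sub_pos.2 hxz)]
    rw [hdist] at h ⊢
    obtain ⟨s₀, hs₀, s₁, hs₁, h0, h1, h2⟩ :=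
      key hxz (τ := 1 - t) ⟨sub_pos.2 ht.2, by linarith [ht.1]⟩ hz hx h
    rw [sub_sub_cancel] at h0 h2
    refine ⟨s₁, hs₁, s₀, hs₀, h1, h0, ?_⟩
    rw [add_comm ((1 - t) * x), add_comm (s₁ * _)]
    exact h2

/-- The pointwise inequality behind the `CD`-condition. -/
theorem ofReal_rpow_le_tau {K N n t a b x z : ℝ} {g : ℝ → ℝ} (hNn : N + 1 ≤ n) (hn : n < 0)
    (hg : IsSturmConvex (K / N) g) (hg0 : ∀ y, 0 ≤ g y) (ht : t ∈ Icc (0 : ℝ) 1)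
    (ha : 0 < a) (hb : 0 < b) (hx : 0 < g x) (hz : 0 < g z)
    (hxz : 0 < g ((1 - t) * x + t * z)) :
    ENNReal.ofReal ((((1 - t) * a + t * b) * g ((1 - t) * x + t * z) ^ N) ^ (1 / n)) ≤
      tau K n (1 - t) (dist x z) * ENNReal.ofReal ((a * g x ^ N) ^ (1 / n)) +
        tau K n t (dist x z) * ENNReal.ofReal ((b * g z ^ N) ^ (1 / n)) := by
  -- At an endpoint time the coefficient of the surviving term is τ^{(1)} ≥ 1, and the other term is
  -- simply dropped.
  rcases ht.1.eq_or_lt with h0 | h0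
  · subst h0
    simp only [sub_zero, one_mul, zero_mul, add_zero]
    exact le_add_right (le_mul_of_one_le_left' (one_le_tau_one hn dist_nonneg))
  rcases ht.2.eq_or_lt with h1 | h1
  · subst h1
    simp only [sub_self, one_mul, zero_mul, zero_add]
    exact le_add_left (le_mul_of_one_le_left' (one_le_tau_one hn dist_nonneg))
  have h1' := sub_pos.2 h1
  rcases le_or_gt (K * dist x z ^ 2) ((n - 1) * Real.pi ^ 2) with h | h
  · have : 0 < (a * g x ^ N) ^ (1 / n) :=
      Real.rpow_pos_of_pos (mul_pos ha (Real.rpow_pos_of_pos hx _)) _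
    rw [tau_eq_top hn h, ENNReal.top_mul (ENNReal.ofReal_pos.2 this).ne', top_add]
    exact le_top
  obtain ⟨s₀, hs₀, s₁, hs₁, e0, e1, hle⟩ :=
    hg.exists_sigma (M := n - 1) (by linarith) (by linarith) hg0 ⟨h0, h1⟩ hx hz h
  rw [tau_eq_ofReal h1' hs₀ e0, tau_eq_ofReal h0 hs₁ e1,
    ← ENNReal.ofReal_mul (by positivity), ← ENNReal.ofReal_mul (by positivity),
    ← ENNReal.ofReal_add (by positivity) (by positivity)]
  refine ENNReal.ofReal_le_ofReal ?_
  have hp : 1 ≤ (n - 1) / n := (one_le_div_of_neg hn).2 (by linarith)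
  have hpn : 1 - (n - 1) / n = 1 / n := by
    have := hn.ne
    field_simp
    ring
  have hn1 : n - 1 ≠ 0 := by linarith
  have hNn' : N / (n - 1) * ((n - 1) / n) = N * (1 / n) := by field_simp
  -- Here p = (n-1)/n, so 1 - p = 1/n and (g^{N/(n-1)})^p = g^{N/n}.
  have hH := rpow_one_sub_mul_rpow_add_le hp (mul_pos h1' ha) (mul_pos h0 hb)
    (mul_nonneg hs₀.le (Real.rpow_nonneg hx.le (N / (n - 1))))
    (mul_nonneg hs₁.le (Real.rpow_nonneg hz.le (N / (n - 1))))
  have hA : 0 < (1 - t) * a + t * b := by positivity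
  rw [Real.mul_rpow hs₀.le (by positivity), Real.mul_rpow hs₁.le (by positivity),
    ← Real.rpow_mul hx.le, ← Real.rpow_mul hz.le, hNn', hpn, Real.mul_rpow h1'.le ha.le,
    Real.mul_rpow h0.le hb.le] at hH
  rw [Real.mul_rpow hA.le (by positivity), Real.mul_rpow ha.le (by positivity),
    Real.mul_rpow hb.le (by positivity), ← Real.rpow_mul hxz.le, ← Real.rpow_mul hx.le,
    ← Real.rpow_mul hz.le]
  calc _ = ((1 - t) * a + t * b) ^ (1 / n) *
          (g ((1 - t) * x + t * z) ^ (N / (n - 1))) ^ ((n - 1) / n) := by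
        rw [← Real.rpow_mul hxz.le, hNn']
    _ ≤ _ := mul_le_mul_of_nonneg_left
        (Real.rpow_le_rpow (by positivity) hle (by linarith)) (by positivity)
    _ ≤ _ := hH
    _ = _ := by ring

/-! ### The measure g^N dx as a quasi-Radon measure -/

/-- The measure with density `g ^ N`. -/
noncomputable def powMeasure (g : ℝ → ℝ) (N : ℝ) : Measure ℝ :=
  volume.withDensity fun x => ENNReal.ofReal (g x) ^ N

section PowMeasure

variable {g : ℝ → ℝ} {N : ℝ}

theorem measurable_ofReal_rpow (hg : Continuous g) (N : ℝ) :
    Measurable fun x => ENNReal.ofReal (g x) ^ N := by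
  have := hg.measurable
  fun_prop

theorem powMeasure_absolutelyContinuous : powMeasure g N ≪ volume :=
  withDensity_absolutelyContinuous _ _

theorem absolutelyContinuous_powMeasure (hN : N < 0) (hg : Continuous g) :
    volume ≪ powMeasure g N :=
  withDensity_absolutelyContinuous' (measurable_ofReal_rpow hg N).aemeasurable
    (ae_of_all _ fun x h => by
      rcases ENNReal.rpow_eq_zero_iff.1 h with h1 | h1
      · linarith [h1.2]
      · exact absurd h1.1 ENNReal.ofReal_ne_top)

theorem sigmaFinite_powMeasure (hpos : ∀ᵐ x, 0 < g x) :
    SigmaFinite (powMeasure g N) :=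
  SigmaFinite.withDensity_of_ne_top (by
    filter_upwards [hpos] with x hx
    rw [ENNReal.ofReal_rpow_of_pos hx]
    exact ENNReal.ofReal_ne_top)

/-- The density is ∞ at zeros of g, and m can be infinite on all their neighbourhoods; only
effective local finiteness can be expected. -/
theorem isMetricMeasureSpace_powMeasure (hN : N < 0) (hg : Continuous g)
    (hpos : ∀ᵐ x, 0 < g x) : IsMetricMeasureSpace (powMeasure g N) := by
  have := sigmaFinite_powMeasure (N := N) hpos
  refine ⟨inferInstance, inferInstance, inferInstance, fun h0 => ?_, ⟨fun A hA hA0 => ?_, ?_⟩⟩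
  · have : volume (univ : Set ℝ) = 0 :=
      absolutelyContinuous_powMeasure hN hg (by rw [h0]; rfl)
    simp at this
  -- On U k the density is at most (k+1)^{-N} and the ball has finite length, so m is finite there.
  -- The sets U k cover {g > 0}, hence almost everything.
  · set U : ℕ → Set ℝ := fun k => {x | 1 / ((k : ℝ) + 1) < g x} ∩ Metric.ball 0 k
    have hU : ∀ k, IsOpen (U k) := fun k =>
      (isOpen_lt continuous_const hg).inter Metric.isOpen_ball
    have hUfin : ∀ k, powMeasure g N (U k) < ∞ := by
      intro k
      have hk : (0 : ℝ) < 1 / ((k : ℝ) + 1) := by positivity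
      rw [powMeasure, withDensity_apply _ (hU k).measurableSet]
      refine (setLIntegral_mono (g := fun _ => ENNReal.ofReal (1 / ((k : ℝ) + 1)) ^ N)
        measurable_const fun x hx => ?_).trans_lt ?_
      · rw [ENNReal.ofReal_rpow_of_pos hk, ENNReal.ofReal_rpow_of_pos (hk.trans hx.1)]
        exact ENNReal.ofReal_le_ofReal (Real.rpow_le_rpow_of_nonpos hk hx.1.le hN.le)
      rw [setLIntegral_const, ENNReal.ofReal_rpow_of_pos hk]
      exact ENNReal.mul_lt_top ENNReal.ofReal_lt_top
        ((measure_mono inter_subset_right).trans_lt measure_ball_lt_top)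
    by_contra! hc
    have hnull : powMeasure g N (⋃ k, A ∩ U k) = 0 :=
      measure_iUnion_null fun k => nonpos_iff_eq_zero.1 (hc (U k) (hU k) (hUfin k))
    refine hA0.ne' (nonpos_iff_eq_zero.1 ((measure_mono_ae ?_).trans_eq hnull))
    filter_upwards [powMeasure_absolutelyContinuous.ae_le hpos] with x hx hxA
    obtain ⟨k, hk⟩ := exists_nat_gt (max (1 / g x) |x|)
    have hk1 := (le_max_left _ _).trans_lt hk
    have hk2 := (le_max_right _ _).trans_lt hk
    refine mem_iUnion.2 ⟨k, hxA, ?_, by simpa using hk2⟩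
    show 1 / ((k : ℝ) + 1) < g x
    rw [div_lt_iff₀ (by positivity)]
    rw [div_lt_iff₀ hx] at hk1
    nlinarith
  -- By σ-finiteness it suffices to approximate sets of finite measure, where the restricted measure
  -- is a finite Borel measure on a metric space.
  · refine Measure.InnerRegularWRT.trans ?_ Measure.InnerRegularWRT.of_sigmaFinite
    intro A hA r hr
    have hfin : IsFiniteMeasure ((powMeasure g N).restrict A) :=
      ⟨by simpa using hA.2.lt_top⟩
    have hr' : r < (powMeasure g N).restrict A A := by rwa [Measure.restrict_apply_self]
    obtain ⟨F, hFA, hF, hrF⟩ := hA.1.exists_lt_isClosed_of_ne_top (measure_ne_top _ _) hr'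
    exact ⟨F, hFA, hF, hrF.trans_le (Measure.restrict_apply_le _ _)⟩

end PowMeasure

/-! ### Entropies along the interpolation and the curvature-dimension condition -/

/-- The Rényi entropy of the image of Lebesgue measure under a differentiable injection. -/
theorem renyiEntropy_map {g : ℝ → ℝ} {N : ℝ} (hN : N < 0) (hg : Continuous g)
    (hpos : ∀ᵐ x, 0 < g x) {D : Set ℝ} (hD : MeasurableSet D) {X X' : ℝ → ℝ}
    (hX : Measurable X) (hX' : Measurable X') [IsFiniteMeasure (volume.restrict D)]
    (hderiv : ∀ u ∈ D, HasDerivWithinAt X (X' u) D u) (hX'pos : ∀ u ∈ D, 0 < X' u)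
    (hinj : InjOn X D) :
    (∀ᵐ u ∂volume.restrict D, 0 < g (X u) ∧ ∀ n : ℝ, n < 0 →
      ((volume.restrict D).map X).rnDeriv (powMeasure g N) (X u) ^ (-1 / n) =
        ENNReal.ofReal ((X' u * g (X u) ^ N) ^ (1 / n))) ∧
    ∀ n : ℝ, n < 0 → renyiEntropy n (powMeasure g N) ((volume.restrict D).map X) =
      ∫⁻ u in D, ENNReal.ofReal ((X' u * g (X u) ^ N) ^ (1 / n)) := by
  have hσ := sigmaFinite_powMeasure (N := N) hpos
  set m := powMeasure g N
  set μ := (volume.restrict D).map X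
  have hac : μ ≪ volume := absolutelyContinuous_map_of_deriv_pos hD hX hX' hderiv hX'pos hinj
  have hacm : μ ≪ m := hac.trans (absolutelyContinuous_powMeasure hN hg)
  have hρ : Measurable (μ.rnDeriv m) := Measure.measurable_rnDeriv _ _
  have hμ : m.withDensity (μ.rnDeriv m) = μ := Measure.withDensity_rnDeriv_eq _ _ hacm
  have hμvol : μ = volume.withDensity
      ((fun x => ENNReal.ofReal (g x) ^ N) * μ.rnDeriv m) := by
    rw [withDensity_mul _ (measurable_ofReal_rpow hg N) hρ]
    exact hμ.symm
  have hone := ae_mul_density_eq_one hD hX hX' hderiv hX'pos hinj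
    ((measurable_ofReal_rpow hg N).mul hρ) hμvol
  have hgX : ∀ᵐ u ∂volume.restrict D, 0 < g (X u) :=
    ae_of_ae_map hX.aemeasurable (hac.ae_le hpos)
  have hae : ∀ᵐ u ∂volume.restrict D, 0 < g (X u) ∧ ∀ n : ℝ, n < 0 →
      μ.rnDeriv m (X u) ^ (-1 / n) = ENNReal.ofReal ((X' u * g (X u) ^ N) ^ (1 / n)) := by
    filter_upwards [hone, hgX, ae_restrict_mem hD] with u hu hgu huD
    refine ⟨hgu, fun n _ => ?_⟩
    have hc : 0 < X' u * g (X u) ^ N := mul_pos (hX'pos u huD) (Real.rpow_pos_of_pos hgu _)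
    rw [Pi.mul_apply, ← mul_assoc, ENNReal.ofReal_rpow_of_pos hgu,
      ← ENNReal.ofReal_mul (hX'pos u huD).le] at hu
    rw [ENNReal.eq_inv_of_mul_eq_one_left ((mul_comm _ _).trans hu), neg_div, ENNReal.rpow_neg,
      ENNReal.inv_rpow, inv_inv, ENNReal.ofReal_rpow_of_pos hc]
  refine ⟨hae, fun n hn => ?_⟩
  rw [renyiEntropy, if_pos hacm]
  -- Writing ρ^{(n-1)/n} = ρ · ρ^{-1/n} turns the entropy into an integral of ρ^{-1/n} against the
  -- image measure, which pulls back to D.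
  have hexp : ∀ x, μ.rnDeriv m x ^ ((n - 1) / n) = μ.rnDeriv m x * μ.rnDeriv m x ^ (-1 / n) := by
    intro x
    have h1 : 0 ≤ -1 / n := div_nonneg_of_nonpos (by norm_num) hn.le
    rw [show (n - 1) / n = 1 + -1 / n by have := hn.ne; field_simp; ring,
      ENNReal.rpow_add_of_nonneg _ _ zero_le_one h1, ENNReal.rpow_one]
  simp_rw [hexp]
  have hint : Measurable fun x => μ.rnDeriv m x ^ (-1 / n) := hρ.pow_const _
  rw [← lintegral_map (μ := volume.restrict D)
    (f := fun x => μ.rnDeriv m x ^ (-1 / n)) hint hX |>.trans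
    (lintegral_congr_ae (hae.mono fun u hu => hu.2 n hn))]
  exact (lintegral_withDensity_eq_lintegral_mul m hρ hint).symm.trans (by rw [hμ])

theorem cdCondition_powMeasure {K N : ℝ} (hN : N < 0) {g : ℝ → ℝ}
    (hg : IsSturmConvex (K / N) g) (hg0 : ∀ y, 0 ≤ g y) (hpos : ∀ᵐ x, 0 < g x) :
    CDCondition K (N + 1) (powMeasure g N) := by
  intro μ₀ μ₁ h0 h1 hac0 hac1
  have hcont := hg.continuous
  have := h0.1
  have := h1.1
  obtain ⟨X, hX, hXI, rfl⟩ := exists_quantile μ₀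
  obtain ⟨Y, hY, hYI, rfl⟩ := exists_quantile μ₁
  have hprob : IsProbabilityMeasure (volume.restrict (Ioo (0 : ℝ) 1)) := ⟨by simp⟩
  have hI : ∀ᵐ u ∂volume.restrict (Ioo (0 : ℝ) 1), u ∈ Ioo (0 : ℝ) 1 :=
    ae_restrict_mem measurableSet_Ioo
  -- A set of full measure in (0,1) that works for all t at once: where X' and Y' are positive, so
  -- is (1-t)X' + tY'.
  set D : Set ℝ := {u | u ∈ Ioo (0 : ℝ) 1 ∧ (DifferentiableAt ℝ X u ∧ 0 < deriv X u) ∧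
    (DifferentiableAt ℝ Y u ∧ 0 < deriv Y u)}
  have hD : MeasurableSet D := measurableSet_Ioo.inter
    (((measurableSet_of_differentiableAt ℝ X).inter
      (measurableSet_lt measurable_const (measurable_deriv X))).inter
    ((measurableSet_of_differentiableAt ℝ Y).inter
      (measurableSet_lt measurable_const (measurable_deriv Y))))
  have hDI : D =ᵐ[volume] Ioo (0 : ℝ) 1 := by
    have h2 := (ae_restrict_iff' measurableSet_Ioo).1 (ae_deriv_pos_of_monotoneOn isOpen_Ioo hX hXI
      (hac0.trans powMeasure_absolutelyContinuous))
    have h3 := (ae_restrict_iff' measurableSet_Ioo).1 (ae_deriv_pos_of_monotoneOn isOpen_Ioo hY hYI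
      (hac1.trans powMeasure_absolutelyContinuous))
    filter_upwards [h2, h3] with u h2 h3
    exact propext ⟨fun hu => hu.1, fun hu => ⟨hu, h2 hu, h3 hu⟩⟩
  have hlam : volume.restrict (Ioo (0 : ℝ) 1) = volume.restrict D :=
    (Measure.restrict_congr_set hDI).symm
  have hfinD : IsFiniteMeasure (volume.restrict D) := hlam ▸ inferInstance
  have hXY := comonotone_of_monotoneOn hXI hYI
  refine ⟨_, hXY.mem_optimalCouplings hI hX hY, _,
    isGeodesic_map_displacement hI hX hY hXI hYI,
    fun t ht => isP2_map_displacement hX hY h0 h1 ht, fun n hn _ _ t ht => ?_⟩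
  -- Times 0 and 1 give the endpoint densities along X and Y; time t gives the entropy on the left
  -- and the positivity of g at the intermediate point.
  have hentropy : ∀ s ∈ Icc (0 : ℝ) 1,
      (∀ᵐ u ∂volume.restrict D, 0 < g (displacement X Y s u) ∧ ∀ n : ℝ, n < 0 →
        ((volume.restrict D).map (displacement X Y s)).rnDeriv (powMeasure g N)
          (displacement X Y s u) ^ (-1 / n) =
          ENNReal.ofReal ((displacement (deriv X) (deriv Y) s u *
            g (displacement X Y s u) ^ N) ^ (1 / n))) ∧
      ∀ n : ℝ, n < 0 →
        renyiEntropy n (powMeasure g N) ((volume.restrict D).map (displacement X Y s)) =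
        ∫⁻ u in D, ENNReal.ofReal ((displacement (deriv X) (deriv Y) s u *
          g (displacement X Y s u) ^ N) ^ (1 / n)) := by
    intro s hs
    have hd : ∀ u ∈ D, HasDerivAt (displacement X Y s) (displacement (deriv X) (deriv Y) s u) u :=
      fun u hu => (hu.2.1.1.hasDerivAt.const_mul _).add (hu.2.2.1.hasDerivAt.const_mul _)
    have hp : ∀ u ∈ D, 0 < displacement (deriv X) (deriv Y) s u := by
      intro u hu
      rcases hs.1.eq_or_lt with hs0 | hs0
      · rw [← hs0, displacement_zero]; exact hu.2.1.2
      · exact add_pos_of_nonneg_of_pos (mul_nonneg (sub_nonneg.2 hs.2) hu.2.1.2.le)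
          (mul_pos hs0 hu.2.2.2)
    exact renyiEntropy_map hN hcont hpos hD (measurable_displacement hX hY s)
      (measurable_displacement (measurable_deriv X) (measurable_deriv Y) s)
      (fun u hu => (hd u hu).hasDerivWithinAt) hp
      (injOn_of_monotoneOn_of_deriv_pos ordConnected_Ioo (fun u hu => hu.1)
        (monotoneOn_displacement hXI hYI hs) hd hp)
  have e0 := (hentropy 0 (by simp)).1
  have e1 := (hentropy 1 (by simp)).1
  simp only [displacement_zero] at e0
  simp only [displacement_one] at e1
  rw [hlam, (hentropy t ht).2 n hn.2, distortedEntropy]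
  have hm0 := (Measure.measurable_rnDeriv ((volume.restrict D).map X) (powMeasure g N)).pow_const
    (-1 / n)
  have hm1 := (Measure.measurable_rnDeriv ((volume.restrict D).map Y) (powMeasure g N)).pow_const
    (-1 / n)
  have hmd : Measurable fun p : ℝ × ℝ => dist p.1 p.2 := by fun_prop
  -- The coupling is the law of (X,Y), so both sides are now integrals over D and can be compared
  -- pointwise.
  refine le_of_le_of_eq ?_ (lintegral_map
    ((((measurable_tau K n (1 - t)).comp hmd).mul (hm0.comp measurable_fst)).add
    (((measurable_tau K n t).comp hmd).mul (hm1.comp measurable_snd))) (hX.prodMk hY)).symm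
  refine lintegral_mono_ae ?_
  filter_upwards [e0, e1, (hentropy t ht).1, ae_restrict_mem hD] with u h0 h1 hu huD
  simp only [Pi.add_apply, Pi.mul_apply, Function.comp_apply]
  rw [h0.2 n hn.2, h1.2 n hn.2]
  exact ofReal_rpow_le_tau hn.1 hn.2 hg hg0 ht huD.2.1.2 huD.2.2.2 h0.1 h1.1 hu.1

theorem weightedLebesgue_eq_powMeasure {ψ : ℝ → EReal} {N : ℝ} (hN : N < 0)
    (hψ : ∀ x, ψ x < ⊤) :
    weightedLebesgue ψ = powMeasure (fun x => (expWeight ψ N x).toReal) N := by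
  rw [weightedLebesgue, powMeasure]
  congr 1
  ext x
  rw [ENNReal.ofReal_toReal (expWeight_ne_top hN (hψ x)), exp_neg_eq_expWeight_rpow hN (hψ x)]

end NegCD

theorem mainTheorem7 (K N : ℝ) (hN : N < -1) (ψ : ℝ → EReal)
    (hψ_lt_top : ∀ x, ψ x < ⊤)
    (hψ_convex : NegCD.IsKNConvex K N ψ)
    (hψ_null : MeasureTheory.volume {x : ℝ | ψ x = ⊥} = 0) :
    NegCD.IsCDSpace K (N + 1) (NegCD.weightedLebesgue ψ) := by
  have hN0 : N < 0 := by linarith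
  have hg := hψ_convex.isSturmConvex hN0 hψ_lt_top
  have hpos : ∀ᵐ x, 0 < (NegCD.expWeight ψ N x).toReal := by
    filter_upwards [measure_eq_zero_iff_ae_notMem.1 hψ_null] with x hx
    exact ENNReal.toReal_pos (fun h => hx ((NegCD.expWeight_eq_zero_iff hN0 (hψ_lt_top x)).1 h))
      (NegCD.expWeight_ne_top hN0 (hψ_lt_top x))
  rw [NegCD.weightedLebesgue_eq_powMeasure hN0 hψ_lt_top]
  exact ⟨NegCD.isMetricMeasureSpace_powMeasure hN0 hg.continuous hpos,
    NegCD.cdCondition_powMeasure hN0 hg (fun _ => ENNReal.toReal_nonneg) hpos⟩
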